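/- **Theorem 5.3 (moment map on $\hat{\mathcal M}(C_m)$).** Let $S^1=\mathbb R/2\pi\mathbb Z$, $D_s=d/ds$; all maps are smooth. *Curves and Hamiltonians.* Let $\hat{\mathcal M}$ be the space of closed curves $\hat\gamma:S^1\to\mathbb E^2=\mathbb C$ with $|\hat\gamma_s|\equiv1$, and let $\hat\kappa$ be the curvature, $T_s=\hat\kappa\, iT$ with $T=\hat\gamma_s$. Let $\hat\Omega=\frac12(D_s^2+\hat\kappa^2+\hat\kappa_sD_s^{-1}\hat\kappa)$, where on differential polynomials in $\hat\kappa$ the operator $D_s^{-1}$ is taken without constant term. For every $n\ge1$ there is a differential polynomial $\hat h_n$ in $\hat\kappa$ such that $2D_s\frac{\delta\hat H_n}{\delta\hat\kappa}=\hat\Omega^{n-1}\hat\kappa_s$ for $\hat H_n=\int_{S^1}\hat h_n\,ds$, and such that neither $\hat h_n$ nor $\delta\hat H_n/\delta\hat\kappa$ has a constant term (e.g. $\hat h_1=\frac14\hat\kappa^2$, $\hat h_2=\frac1{32}\hat\kappa^4-\frac18\hat\kappa_s^2$); this determines $\hat H_n:\hat{\mathcal M}\to\mathbb R$. For real numbers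 $C=\{c_k\}$ and $m\ge1$ let $$\hat{\mathcal M}(C_m)=\hat H_1^{-1}(c_1)\cap\dots\cap\hat H_m^{-1}(c_m),\qquad T_{\hat\gamma}\hat{\mathcal M}(C_m)=T_{\hat\gamma}\hat{\mathcal M}\cap\bigcap_{k=1}^m\ker (d\hat H_k)_{\hat\gamma},$$ where $T_{\hat\gamma}\hat{\mathcal M}$ consists of the velocities of smooth one-parameter families in $\hat{\mathcal M}$ through $\hat\gamma$. *The form.* Let $\mathcal M^{\mathbb C}$ be the space of curves $\gamma$ in $\mathbb C^2\setminus\{0\}$ with $\det(\gamma,\gamma_s)=1$ that are closed up to sign, $\gamma(s+2\pi)=\pm\gamma(s)$; let $\gamma_{ss}=-\kappa\gamma$ and $\Omega=\frac12D_s^2+2\kappa+\kappa_sD_s^{-1}$. For $X=-\frac12\alpha_s\gamma+\alpha\gamma_s$ and $Y=-\frac12\beta_s\gamma+\beta\gamma_s$ with $\alpha,\beta:S^1\to\mathbb C$ put $$\omega_{m+1}(X,Y)=\int_{S^1}\alpha\,\Omega^{m+1}\beta_s\,ds,$$ where $D_s^{-1}\beta_s=\beta$ and each further $D_s^{-1}$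 is any primitive on $S^1$, whenever these primitives exist. Let $\Phi(\hat\gamma)=(-\hat\gamma_s)^{-1/2}(\hat\gamma,1)\in\mathcal M^{\mathbb C}$, which is determined up to sign; $\omega_{m+1}$ does not change under $\gamma\mapsto-\gamma$. Put $\hat\omega_{m+1}=\Phi^*\omega_{m+1}$. *Claim.* On $T_{\hat\gamma}\hat{\mathcal M}(C_m)$, $\hat\gamma\in\hat{\mathcal M}(C_m)$, the form $\hat\omega_{m+1}$ is defined, does not depend on the choice of the primitives or of the sign of the root, and is real-valued, bilinear and skew-symmetric. The $S^1$-action $\hat\gamma\mapsto\hat\gamma(\,\cdot+\sigma)$ on $\hat{\mathcal M}(C_m)$ is Hamiltonian with respect to $\hat\omega_{m+1}$ with moment map $\hat\mu_{m+1}$ given by $$\hat\mu_{m+1}(\hat\gamma)\left(\frac{\partial}{\partial\sigma}\right)=\hat H_{m+1}(\hat\gamma),\qquad\hat\gamma\in\hat{\mathcal M}(C_m).$$ That is: the action preserves $\hat{\mathcal M}(C_m)$, its tangent spaces and $\hat\omega_{m+1}$; $\hat H_{m+1}$ is invariant; the fundamental vector field $\hat\gamma\mapsto\hat\gamma_s$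 of $\partial/\partial\sigma$ is tangent to $\hat{\mathcal M}(C_m)$; and $d\hat H_{m+1}(Y)=\hat\omega_{m+1}(\hat\gamma_s,Y)$ for all $Y\in T_{\hat\gamma}\hat{\mathcal M}(C_m)$. -/

import Mathlib

open scoped ContDiff

noncomputable section

namespace ClosedCurves

/-! ### Differential polynomials and the modified KdV hierarchy -/

/-- Differential polynomials in one unknown `u` over `ℝ`; the variable `X j` is the `j`-th
derivative of `u`. -/
abbrev DiffPoly : Type := MvPolynomial ℕ ℝ

/-- The total derivative `D_s`: the derivation with `u^(j) ↦ u^(j+1)`. -/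
def totalD : Derivation ℝ DiffPoly DiffPoly :=
  MvPolynomial.mkDerivation ℝ (fun j : ℕ => (MvPolynomial.X (j + 1) : DiffPoly))

/-- The variational derivative `∂p/∂u - D_s (∂p/∂u_s) + D_s² (∂p/∂u_ss) - ⋯`. -/
def varDeriv (p : DiffPoly) : DiffPoly :=
  ∑ j ∈ p.vars, (-1 : DiffPoly) ^ j * (fun q : DiffPoly => totalD q)^[j] (MvPolynomial.pderiv j p)

/-- `IsMKdVFlow n f` says that `f = Ω̂ⁿ u_s`, where
`Ω̂ = (1/2) (D_s² + u² + u_s D_s⁻¹ u)` is the recursion operator of the modified KdV equation.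
Here `w = D_s⁻¹ (u g)` is the differential polynomial without constant term with `D_s w = u g`. -/
def IsMKdVFlow : ℕ → DiffPoly → Prop
  | 0, f => f = MvPolynomial.X 1
  | n + 1, f => ∃ g w : DiffPoly, IsMKdVFlow n g ∧
      totalD w = MvPolynomial.X 0 * g ∧ MvPolynomial.constantCoeff w = 0 ∧
      f = MvPolynomial.C (1 / 2 : ℝ) *
        (totalD (totalD g) + MvPolynomial.X 0 ^ 2 * g + MvPolynomial.X 1 * w)

/-- `p` is a density of the `n`-th Hamiltonian (`n ≥ 1`) of the modified KdV hierarchy: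
`2 D_s (δ/δu ∫ p) = Ω̂ⁿ⁻¹ u_s`, where neither `p` nor its variational derivative has a constant
term. For example `u² / 4` for `n = 1` and `u⁴ / 32 - u_s² / 8` for `n = 2`. These conditions
determine `p` up to a total derivative, hence they determine the functional `∫ p ds`. -/
def IsMKdVDensity (n : ℕ) (p : DiffPoly) : Prop :=
  ∃ k : ℕ, n = k + 1 ∧ MvPolynomial.constantCoeff p = 0 ∧
    MvPolynomial.constantCoeff (varDeriv p) = 0 ∧
    IsMKdVFlow k (2 * totalD (varDeriv p))

/-! ### Closed curves in the Euclidean plane -/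

/-- The space of closed arc-length parametrized smooth curves in the Euclidean plane `ℂ`;
maps on `S¹ = ℝ / 2πℤ` are `2π`-periodic maps on `ℝ`. -/
def MHat : Set (ℝ → ℂ) :=
  {γ | ContDiff ℝ ∞ γ ∧ (∀ s, γ (s + 2 * Real.pi) = γ s) ∧ ∀ s, ‖deriv γ s‖ = 1}

/-- The Euclidean curvature `κ̂`, i.e. `T_s = κ̂ N` with `T = γ_s` and `N = i T`. -/
def curvHat (γ : ℝ → ℂ) (s : ℝ) : ℝ :=
  (star (deriv γ s) * deriv (deriv γ) s).im

/-- The functional `∫_{S¹} p(κ̂, κ̂_s, κ̂_ss, …) ds`. -/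
def functionalHat (p : DiffPoly) (γ : ℝ → ℂ) : ℝ :=
  ∫ s in (0 : ℝ)..(2 * Real.pi),
    MvPolynomial.eval (fun j : ℕ => iteratedDeriv j (curvHat γ) s) p

/-- The common level set of the first `m` Hamiltonians, with values `c 1, …, c m`. -/
def levelHat (h : ℕ → DiffPoly) (c : ℕ → ℝ) (m : ℕ) : Set (ℝ → ℂ) :=
  {γ | γ ∈ MHat ∧ ∀ k, 1 ≤ k → k ≤ m → functionalHat (h k) γ = c k}

/-- `Γ` is a smooth one-parameter family of closed arc-length parametrized curves which starts
at `γ` with velocity `V`. -/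
def IsMotion (Γ : ℝ → ℝ → ℂ) (γ V : ℝ → ℂ) : Prop :=
  ContDiff ℝ ∞ (fun x : ℝ × ℝ => Γ x.1 x.2) ∧ (∀ t, Γ t ∈ MHat) ∧ Γ 0 = γ ∧
    ∀ s, deriv (fun t => Γ t s) 0 = V s

/-- `V` is tangent at `γ` to the level set of the first `m` Hamiltonians: it is a tangent vector of
the space of closed curves (the velocity of a smooth family) and belongs to the kernels of the
differentials of these Hamiltonians. -/
def IsTangentHat (h : ℕ → DiffPoly) (m : ℕ) (γ V : ℝ → ℂ) : Prop :=
  ∃ Γ : ℝ → ℝ → ℂ, IsMotion Γ γ V ∧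
    ∀ k, 1 ≤ k → k ≤ m → HasDerivAt (fun t => functionalHat (h k) (Γ t)) 0 0

/-! ### Complex equicentroaffine curves and the forms `ω_k` -/

/-- The determinant of two vectors of `ℂ²`. -/
def det2 (v w : ℂ × ℂ) : ℂ := v.1 * w.2 - v.2 * w.1

/-- Complex equicentroaffine curves, closed up to sign. (The sign is needed because the square
root in the geometric Miura transformation changes sign along `S¹` when the rotation number of
the curve is odd. All quantities below are invariant under `γ ↦ -γ`.) -/
def MC : Set (ℝ → ℂ × ℂ) :=
  {γ | ContDiff ℝ ∞ γ ∧
    ((∀ s, γ (s + 2 * Real.pi) = γ s) ∨ (∀ s, γ (s + 2 * Real.pi) = -γ s)) ∧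
    ∀ s, det2 (γ s) (deriv γ s) = 1}

/-- The equicentroaffine curvature `κ`, i.e. `γ_ss = -κ γ`. -/
def curvC (γ : ℝ → ℂ × ℂ) (s : ℝ) : ℂ := det2 (deriv γ s) (deriv (deriv γ) s)

/-- Smooth complex functions on `S¹`. -/
def IsSmoothCircle (α : ℝ → ℂ) : Prop :=
  ContDiff ℝ ∞ α ∧ ∀ s, α (s + 2 * Real.pi) = α s

/-- `X = -(1/2) α_s γ + α γ_s` with a function `α` on `S¹`, i.e. `X` is the tangent vector at `γ`
to the space of equicentroaffine curves represented by `α`. -/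
def Represents (γ : ℝ → ℂ × ℂ) (α : ℝ → ℂ) (X : ℝ → ℂ × ℂ) : Prop :=
  IsSmoothCircle α ∧ ∀ s, X s = (-(1 / 2 : ℂ) * deriv α s) • γ s + α s • deriv γ s

/-- `b j = Ω^j β_s` for `j ≤ k`, where `Ω = (1/2) D_s² + 2 κ + κ_s D_s⁻¹` is the recursion operator
of the KdV equation and `a j = D_s⁻¹ (b j)`, `j < k`, are functions on `S¹`, the first of which is
`D_s⁻¹ β_s = β`. -/
structure IsOmegaIterates (κ β : ℝ → ℂ) (k : ℕ) (a b : ℕ → ℝ → ℂ) : Prop where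
  a_zero : a 0 = β
  b_zero : b 0 = deriv β
  circle : ∀ j, j < k → IsSmoothCircle (a j)
  primitive : ∀ j, j < k → deriv (a j) = b j
  step : ∀ j, j < k → ∀ s,
    b (j + 1) s = (1 / 2 : ℂ) * deriv (deriv (b j)) s + 2 * κ s * b j s + deriv κ s * a j s

/-- `ω_k(X, Y) = w`, where `ω_k(X, Y) = ∫_{S¹} α Ω^k β_s ds` for `X = -(1/2) α_s γ + α γ_s` and
`Y = -(1/2) β_s γ + β γ_s`. This is a relation, because `Ω^k β_s` exists only under conditions on
`Y`, and the constants of integration in it drop out only under conditions on `X`. -/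
def HasOmega (k : ℕ) (γ X Y : ℝ → ℂ × ℂ) (w : ℂ) : Prop :=
  γ ∈ MC ∧ ∃ (α β : ℝ → ℂ) (a b : ℕ → ℝ → ℂ),
    Represents γ α X ∧ Represents γ β Y ∧ IsOmegaIterates (curvC γ) β k a b ∧
    w = ∫ s in (0 : ℝ)..(2 * Real.pi), α s * b k s

/-! ### The geometric Miura transformation -/

/-- `δ = Φ(γ) = (-γ_s)^(-1/2) (γ, 1)`, with one of the two smooth branches `ρ` of the root. -/
def IsMiura (γ : ℝ → ℂ) (δ : ℝ → ℂ × ℂ) : Prop :=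
  ∃ ρ : ℝ → ℂ, ContDiff ℝ ∞ ρ ∧ (∀ s, ρ s ^ 2 * (-deriv γ s) = 1) ∧
    ∀ s, δ s = (ρ s * γ s, ρ s)

/-- `W = Φ_* V` at `δ = Φ(γ)`: the velocity at `δ` of the image under `Φ` of a smooth family that
starts at `γ` with velocity `V`. -/
def IsMiuraPush (γ : ℝ → ℂ) (δ : ℝ → ℂ × ℂ) (V : ℝ → ℂ) (W : ℝ → ℂ × ℂ) : Prop :=
  ∃ (Γ : ℝ → ℝ → ℂ) (Δ : ℝ → ℝ → ℂ × ℂ), IsMotion Γ γ V ∧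
    ContDiff ℝ ∞ (fun x : ℝ × ℝ => Δ x.1 x.2) ∧ (∀ t, IsMiura (Γ t) (Δ t)) ∧ Δ 0 = δ ∧
    ∀ s, W s = deriv (fun t => Δ t s) 0

/-- `(Φ^* ω_k)(V, V') = w` at `γ`. -/
def HasOmegaHat (k : ℕ) (γ V V' : ℝ → ℂ) (w : ℂ) : Prop :=
  ∃ (δ W W' : ℝ → ℂ × ℂ), IsMiura γ δ ∧ IsMiuraPush γ δ V W ∧ IsMiuraPush γ δ V' W' ∧
    HasOmega k δ W W' w

/-! ### The circle action and its moment map -/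

/-- The action of `σ ∈ S¹ = ℝ / 2πℤ` by parameter shift. -/
def shift (σ : ℝ) (γ : ℝ → ℂ) : ℝ → ℂ := fun s => γ (s + σ)

/-- The fundamental vector field of `∂/∂σ`. -/
def fundamentalField (γ : ℝ → ℂ) : ℝ → ℂ := fun s => deriv (fun σ => shift σ γ s) 0

/-- `form` is a skew-symmetric bilinear form on the tangent spaces `Tan γ`, `γ ∈ M`. -/
structure IsTwoForm (M : Set (ℝ → ℂ)) (Tan : (ℝ → ℂ) → (ℝ → ℂ) → Prop)
    (form : (ℝ → ℂ) → (ℝ → ℂ) → (ℝ → ℂ) → ℝ) : Prop where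
  skew : ∀ γ ∈ M, ∀ V V', Tan γ V → Tan γ V' → form γ V V' = -form γ V' V
  linear : ∀ γ ∈ M, ∀ (V V₁ V₂ V₃ : ℝ → ℂ) (r : ℝ), Tan γ V → Tan γ V₁ → Tan γ V₂ → Tan γ V₃ →
    (∀ s, V₃ s = r * V₁ s + V₂ s) → form γ V V₃ = r * form γ V V₁ + form γ V V₂

/-- The `S¹`-action by parameter shift on `M` (a subset of the space of closed curves, with tangent
spaces `Tan γ`) is Hamiltonian with respect to `form`, and `μ` is (the value on `∂/∂σ` of) its
moment map: the action preserves `M`, its tangent spaces, and `form`; `μ` is invariant; and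
`dμ = form(A, ·)` for the fundamental vector field `A` of `∂/∂σ`. -/
structure IsShiftMomentMap (M : Set (ℝ → ℂ)) (Tan : (ℝ → ℂ) → (ℝ → ℂ) → Prop)
    (form : (ℝ → ℂ) → (ℝ → ℂ) → (ℝ → ℂ) → ℝ) (μ : (ℝ → ℂ) → ℝ) : Prop where
  maps : ∀ γ ∈ M, ∀ σ, shift σ γ ∈ M
  maps_tangent : ∀ γ ∈ M, ∀ σ V, Tan γ V → Tan (shift σ γ) (shift σ V)
  form_invariant : ∀ γ ∈ M, ∀ σ V V', Tan γ V → Tan γ V' →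
    form (shift σ γ) (shift σ V) (shift σ V') = form γ V V'
  moment_invariant : ∀ γ ∈ M, ∀ σ, μ (shift σ γ) = μ γ
  fundamental_tangent : ∀ γ ∈ M, Tan γ (fundamentalField γ)
  differential : ∀ γ ∈ M, ∀ V, Tan γ V → ∀ Γ, IsMotion Γ γ V →
    HasDerivAt (fun t => μ (Γ t)) (form γ (fundamentalField γ) V) 0

end ClosedCurves

end

/-!
In the moving frame, a deformation of `γ ∈ MHat` has velocity `q T` with `q_s + i κ̂ q = i l` and
changes `κ̂` with velocity `l_s`. Under the Miura transformation `q` represents the velocity of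
`Φ(γ)`, the curvature becomes `κ = κ̂² / 4 + i κ̂_s / 2`, and `Ω D_s` maps `q` to
`D_s ((w + i l_s) / 2)` with `w_s = κ̂ l_s`: the recursion operator of the KdV equation turns into
that of the modified KdV equation. The form is independent of the primitives and skew because
`Ω D_s = ½ D_s³ + 2 κ D_s + κ_s` is skew-adjoint.

Let `g_n = D_s⁻¹ (Ω̂ⁿ κ̂_s)`. The iterates of the constant function `1` are given by the `g_n`.
Hence the obstruction to a further primitive of the iterates of `q`, which is `∫ κ̂ l_s` with the
`l` of the last iterate, equals by skewness `∫ g_j l_s` with the `l` of `q` itself. This is a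
multiple of the variation of `Ĥ_(j+1)` and vanishes for tangent vectors of the level set.
Similarly, the pairing of `1` with the last iterate is `½ ∫ g_m l_s = dĤ_(m+1)`.

The Hamiltonians exist by the trace identity: the variational derivative of `D_s⁻¹ (κ̂ Ω̂ⁿ κ̂_s)` is
`(2 n + 1) g_n`.
-/

noncomputable section

namespace ClosedCurves

section PolynomialDerivations

open MvPolynomial

variable {σ R : Type*}

theorem derivation_comm_of_X [CommRing R]
    {d₁ d₂ : Derivation R (MvPolynomial σ R) (MvPolynomial σ R)}
    (h : ∀ i, d₁ (d₂ (X i)) = d₂ (d₁ (X i))) (p : MvPolynomial σ R) :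
    d₁ (d₂ p) = d₂ (d₁ p) := by
  have hcomm : ⁅d₁, d₂⁆ = 0 := derivation_ext fun i => by
    rw [Derivation.commutator_apply, h, sub_self, Derivation.zero_apply]
  rw [← sub_eq_zero, ← Derivation.commutator_apply, hcomm, Derivation.zero_apply]

theorem pderiv_comm [CommRing R] (i j : σ) (p : MvPolynomial σ R) :
    pderiv i (pderiv j p) = pderiv j (pderiv i p) := by
  classical
  refine derivation_comm_of_X (fun k => ?_) p
  rw [pderiv_X, pderiv_X, Pi.single_apply, Pi.single_apply]
  split_ifs <;> simp

theorem derivation_eq_sum_pderiv [CommRing R]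
    (d : Derivation R (MvPolynomial σ R) (MvPolynomial σ R)) (p : MvPolynomial σ R) :
    d p = ∑ i ∈ p.vars, pderiv i p * d (X i) := by
  classical
  have hsum (q : MvPolynomial σ R) :
      (∑ i ∈ p.vars, d (X i) • pderiv i : Derivation R (MvPolynomial σ R) (MvPolynomial σ R)) q
        = ∑ i ∈ p.vars, pderiv i q * d (X i) := by
    rw [← Derivation.coeFnAddMonoidHom_apply, map_sum, Finset.sum_apply]
    exact Finset.sum_congr rfl fun i _ => mul_comm _ _
  rw [← hsum]
  refine derivation_eq_of_forall_mem_vars fun j hj => ?_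
  rw [hsum, Finset.sum_eq_single_of_mem j hj fun i _ hij => by
    rw [pderiv_X_of_ne hij.symm, zero_mul], pderiv_X_self, one_mul]

theorem eq_C_of_forall_pderiv_eq_zero [CommSemiring R] [NoZeroDivisors R] [CharZero R]
    {p : MvPolynomial σ R} (h : ∀ i, pderiv i p = 0) : p = C (constantCoeff p) := by
  classical
  ext m
  rw [coeff_C]
  split_ifs with hm
  · rw [← hm, constantCoeff_eq]
  · obtain ⟨i, hi⟩ : ∃ i, m i ≠ 0 := not_forall.mp fun h0 => hm (Finsupp.ext h0).symm
    have hcoeff := coeff_pderiv (i := i) p (m - Finsupp.single i 1)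
    rw [h i, coeff_zero, tsub_add_cancel_of_le (Finsupp.single_le_iff.mpr (by omega))] at hcoeff
    exact (mul_eq_zero.mp hcoeff.symm).resolve_right (Nat.cast_add_one_ne_zero _)

theorem hasDerivAt_eval_of_forall_X
    (d : Derivation ℝ (MvPolynomial σ ℝ) (MvPolynomial σ ℝ)) {f : ℝ → σ → ℝ} {t : ℝ}
    (h : ∀ i, HasDerivAt (fun x => f x i) (eval (f t) (d (X i))) t) (p : MvPolynomial σ ℝ) :
    HasDerivAt (fun x => eval (f x) p) (eval (f t) (d p)) t := by
  induction p using MvPolynomial.induction_on with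
  | C a => simpa only [eval_C, derivation_C, map_zero] using hasDerivAt_const t a
  | add p q hp hq => simpa only [map_add] using hp.fun_add hq
  | mul_X p i hp =>
    simp only [map_mul, eval_X, Derivation.leibniz, smul_eq_mul, map_add]
    exact (hp.fun_mul (h i)).congr_deriv (by ring)

theorem hasDerivAt_eval {f : ℝ → σ → ℝ} {f' : σ → ℝ} {t : ℝ}
    (h : ∀ i, HasDerivAt (fun x => f x i) (f' i) t) (p : MvPolynomial σ ℝ) :
    HasDerivAt (fun x => eval (f x) p) (∑ i ∈ p.vars, eval (f t) (pderiv i p) * f' i) t := by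
  have hd := hasDerivAt_eval_of_forall_X (mkDerivation ℝ fun i => C (f' i)) (f := f) (t := t)
    (fun i => by simpa only [mkDerivation_X, eval_C] using h i) p
  rw [derivation_eq_sum_pderiv] at hd
  simpa only [mkDerivation_X, map_sum, map_mul, eval_C] using hd

end PolynomialDerivations

/-! ### The variational derivative -/

section VariationalDerivative

open MvPolynomial

theorem totalD_X (j : ℕ) : totalD (X j) = X (j + 1) := mkDerivation_X ..

theorem constantCoeff_totalD (p : DiffPoly) : constantCoeff (totalD p) = 0 := by
  rw [derivation_eq_sum_pderiv, map_sum]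
  exact Finset.sum_eq_zero fun j _ => by rw [totalD_X, map_mul, constantCoeff_X, mul_zero]

theorem pderiv_succ_totalD (i : ℕ) (p : DiffPoly) :
    pderiv (i + 1) (totalD p) = totalD (pderiv (i + 1) p) + pderiv i p := by
  have hcomm : ⁅pderiv (i + 1), totalD⁆ = (pderiv i : Derivation ℝ DiffPoly DiffPoly) :=
    derivation_ext fun j => by
      rw [Derivation.commutator_apply, totalD_X, pderiv_X, pderiv_X, pderiv_X, Pi.single_apply,
        Pi.single_apply, Pi.single_apply]
      split_ifs <;> simp_all
  rw [← hcomm, Derivation.commutator_apply, add_sub_cancel]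

theorem exists_forall_pderiv_eq_zero (p : DiffPoly) : ∃ N, ∀ i, N ≤ i → pderiv i p = 0 :=
  ⟨p.vars.sup id + 1, fun _ hi => pderiv_eq_zero_of_notMem_vars fun hmem =>
    absurd (Finset.le_sup (f := id) hmem) (by simpa using hi)⟩

theorem pderiv_eq_zero_of_pderiv_totalD {N : ℕ} {p : DiffPoly}
    (h : ∀ i, N < i → pderiv i (totalD p) = 0) : ∀ i, N ≤ i → pderiv i p = 0 := by
  obtain ⟨M, hM⟩ := exists_forall_pderiv_eq_zero p
  intro i hi
  rcases le_total M i with hMi | hiM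
  · exact hM i hMi
  · refine Nat.decreasingInduction' (P := fun k => pderiv k p = 0) (fun k _ hik ih => ?_) hiM
      (hM M le_rfl)
    simpa only [pderiv_succ_totalD, ih, map_zero, zero_add] using h (k + 1) (by omega)

theorem eq_of_totalD_eq {p q : DiffPoly} (h : totalD p = totalD q)
    (hc : constantCoeff p = constantCoeff q) : p = q := by
  have hpq : ∀ i, pderiv i (p - q) = 0 := fun i =>
    pderiv_eq_zero_of_pderiv_totalD (N := 0) (fun j _ => by rw [map_sub, h, sub_self, map_zero])
      i i.zero_le
  rw [← sub_eq_zero, eq_C_of_forall_pderiv_eq_zero hpq, map_sub, hc, sub_self, C_0]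

/-- The evolutionary derivation with characteristic `v`, i.e. the first variation of a differential
polynomial when `u` moves with velocity `v`. -/
def evolD (v : DiffPoly) : Derivation ℝ DiffPoly DiffPoly :=
  mkDerivation ℝ fun j => totalD^[j] v

theorem evolD_X (v : DiffPoly) (j : ℕ) : evolD v (X j) = totalD^[j] v := mkDerivation_X ..

theorem evolD_totalD (v p : DiffPoly) : evolD v (totalD p) = totalD (evolD v p) :=
  derivation_comm_of_X
    (fun i => by rw [totalD_X, evolD_X, evolD_X, Function.iterate_succ_apply']) p

/-- The total derivatives, i.e. the densities whose integral over the circle vanishes for formal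
reasons. -/
def exactPolys : Submodule ℝ DiffPoly := LinearMap.range (totalD : DiffPoly →ₗ[ℝ] DiffPoly)

theorem totalD_mem_exactPolys (p : DiffPoly) : totalD p ∈ exactPolys := ⟨p, rfl⟩

theorem mem_exactPolys {p : DiffPoly} : p ∈ exactPolys ↔ ∃ q, totalD q = p := Iff.rfl

theorem mul_iterate_totalD_sub_mem_exactPolys (j : ℕ) (q v : DiffPoly) :
    q * totalD^[j] v - (-1) ^ j * totalD^[j] q * v ∈ exactPolys := by
  induction j generalizing q with
  | zero => simp
  | succ j ih =>
    convert exactPolys.sub_mem (totalD_mem_exactPolys (q * totalD^[j] v)) (ih (totalD q)) using 1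
    rw [Function.iterate_succ_apply', Function.iterate_succ_apply, Derivation.leibniz, smul_eq_mul,
      smul_eq_mul]
    ring

theorem evolD_sub_varDeriv_mul_mem_exactPolys (v p : DiffPoly) :
    evolD v p - varDeriv p * v ∈ exactPolys := by
  rw [derivation_eq_sum_pderiv, varDeriv, Finset.sum_mul, ← Finset.sum_sub_distrib]
  exact exactPolys.sum_mem fun j _ => by
    rw [evolD_X]; exact mul_iterate_totalD_sub_mem_exactPolys j _ v

theorem eq_zero_of_forall_mul_mem_exactPolys {r : DiffPoly} (h : ∀ v, r * v ∈ exactPolys) :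
    r = 0 := by
  -- A total derivative is affine in its top derivative, but `r * X (N + 1) ^ 2` is quadratic.
  obtain ⟨N, hN⟩ := exists_forall_pderiv_eq_zero r
  obtain ⟨q, hq⟩ := mem_exactPolys.mp (h (X (N + 1) ^ 2))
  have hq_order : ∀ i, N + 1 ≤ i → pderiv i q = 0 :=
    pderiv_eq_zero_of_pderiv_totalD fun i hi => by
      rw [hq, pderiv_mul, hN i (by omega), pderiv_pow, pderiv_X_of_ne (by omega)]
      ring
  have hr : pderiv (N + 1) (r * X (N + 1) ^ 2) = r * X (N + 1) + r * X (N + 1) := by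
    rw [pderiv_mul, hN _ N.le_succ, pderiv_pow, pderiv_X_self]
    ring
  have hzero : 2 * r = 0 := by
    calc 2 * r = pderiv (N + 1) (r * X (N + 1) + r * X (N + 1)) := by
          rw [map_add, pderiv_mul, hN _ N.le_succ, pderiv_X_self]
          ring
      _ = pderiv (N + 1) (pderiv N q) := by
          rw [← hr, ← hq, pderiv_succ_totalD, hq_order _ le_rfl, map_zero, zero_add]
      _ = 0 := by rw [pderiv_comm, hq_order _ le_rfl, map_zero]
  exact (mul_eq_zero.mp hzero).resolve_left two_ne_zero

theorem varDeriv_eq_of_forall_mem_exactPolys {p q : DiffPoly}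
    (h : ∀ v, evolD v p - q * v ∈ exactPolys) : varDeriv p = q := by
  refine sub_eq_zero.mp (eq_zero_of_forall_mul_mem_exactPolys fun v => ?_)
  rw [sub_mul]
  convert exactPolys.sub_mem (h v) (evolD_sub_varDeriv_mul_mem_exactPolys v p) using 1
  ring

end VariationalDerivative

/-! ### The modified KdV hierarchy -/

section MKdVHierarchy

open MvPolynomial

/-- The inverse total derivative `D_s⁻¹`: the primitive without constant term, which exists for
`p ∈ exactPolys` only. -/
def invTotalD (p : DiffPoly) : DiffPoly :=
  Classical.epsilon fun w => totalD w = p ∧ constantCoeff w = 0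

theorem invTotalD_spec {p : DiffPoly} (h : p ∈ exactPolys) :
    totalD (invTotalD p) = p ∧ constantCoeff (invTotalD p) = 0 := by
  obtain ⟨q, rfl⟩ := mem_exactPolys.mp h
  refine Classical.epsilon_spec (p := fun w => totalD w = totalD q ∧ constantCoeff w = 0)
    ⟨q - C (constantCoeff q), ?_, ?_⟩
  · rw [map_sub, derivation_C, sub_zero]
  · rw [map_sub, constantCoeff_C, sub_self]

/-- The gradients of the modified KdV hierarchy, `gradPoly n = D_s⁻¹ (Ω̂ⁿ u_s)`, which are twice the
variational derivatives of the Hamiltonians. -/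
def gradPoly : ℕ → DiffPoly
  | 0 => X 0
  | n + 1 => (1 / 2 : ℝ) •
      (totalD (totalD (gradPoly n)) + X 0 * invTotalD (X 0 * totalD (gradPoly n)))

/-- The nonlocal terms `D_s⁻¹ (u Ω̂ⁿ u_s)` of the modified KdV hierarchy. -/
def potPoly (n : ℕ) : DiffPoly := invTotalD (X 0 * totalD (gradPoly n))

theorem gradPoly_zero : gradPoly 0 = X 0 := rfl

theorem gradPoly_succ (n : ℕ) :
    gradPoly (n + 1) = (1 / 2 : ℝ) • (totalD (totalD (gradPoly n)) + X 0 * potPoly n) := rfl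

theorem constantCoeff_gradPoly (n : ℕ) : constantCoeff (gradPoly n) = 0 := by
  cases n with
  | zero => exact constantCoeff_X (R := ℝ) 0
  | succ n => rw [gradPoly_succ, constantCoeff_smul, map_add, constantCoeff_totalD, map_mul,
      constantCoeff_X, zero_mul, add_zero, smul_zero]

theorem mul_totalD_sub_mem_exactPolys {p q P Q : DiffPoly} (hP : totalD P = X 0 * totalD p)
    (hQ : totalD Q = X 0 * totalD q) :
    p * totalD (totalD (totalD q) + X 0 * Q) - (totalD (totalD p) + X 0 * P) * totalD q
      ∈ exactPolys := by
  refine mem_exactPolys.mpr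
    ⟨p * (totalD (totalD q) + X 0 * Q) - totalD p * totalD q - P * Q, ?_⟩
  simp only [map_add, map_sub, Derivation.leibniz, smul_eq_mul, hP, hQ]
  ring

theorem gradPoly_mul_totalD_sub_mem_exactPolys {j k : ℕ}
    (hj : totalD (potPoly j) = X 0 * totalD (gradPoly j))
    (hk : totalD (potPoly k) = X 0 * totalD (gradPoly k)) :
    gradPoly j * totalD (gradPoly (k + 1)) - gradPoly (j + 1) * totalD (gradPoly k)
      ∈ exactPolys := by
  rw [gradPoly_succ, gradPoly_succ, Derivation.map_smul, mul_smul_comm, smul_mul_assoc, ← smul_sub]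
  exact exactPolys.smul_mem _ (mul_totalD_sub_mem_exactPolys hj hk)

theorem X_mul_totalD_gradPoly_mem_exactPolys (n : ℕ) :
    X 0 * totalD (gradPoly n) ∈ exactPolys := by
  induction n using Nat.strong_induction_on with
  | _ n ih =>
    have hpot : ∀ j < n, totalD (potPoly j) = X 0 * totalD (gradPoly j) :=
      fun j hj => (invTotalD_spec (ih j hj)).1
    have hmove : ∀ j ≤ n,
        X 0 * totalD (gradPoly n) - gradPoly j * totalD (gradPoly (n - j)) ∈ exactPolys := by
      intro j
      induction j with
      | zero => simp [gradPoly_zero]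
      | succ j ihj =>
        intro hj
        have hstep := gradPoly_mul_totalD_sub_mem_exactPolys (hpot j (by omega))
          (hpot (n - (j + 1)) (by omega))
        rw [show n - (j + 1) + 1 = n - j by omega] at hstep
        simpa only [sub_add_sub_cancel] using exactPolys.add_mem (ihj (by omega)) hstep
    -- Moving all `n` factors over shows that the expression is skew modulo total derivatives.
    have hskew : X 0 * totalD (gradPoly n) - gradPoly n * totalD (X 0) ∈ exactPolys := by
      simpa only [Nat.sub_self, gradPoly_zero] using hmove n le_rfl
    have htwice : (2 : ℝ) • (X 0 * totalD (gradPoly n)) ∈ exactPolys := by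
      convert exactPolys.add_mem hskew (totalD_mem_exactPolys (gradPoly n * X 0)) using 1
      rw [Derivation.leibniz, smul_eq_mul, smul_eq_mul, two_smul]
      ring
    exact (exactPolys.smul_mem_iff two_ne_zero).mp htwice

theorem totalD_potPoly (n : ℕ) : totalD (potPoly n) = X 0 * totalD (gradPoly n) :=
  (invTotalD_spec (X_mul_totalD_gradPoly_mem_exactPolys n)).1

theorem constantCoeff_potPoly (n : ℕ) : constantCoeff (potPoly n) = 0 :=
  (invTotalD_spec (X_mul_totalD_gradPoly_mem_exactPolys n)).2

theorem totalD_gradPoly_succ (n : ℕ) :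
    totalD (gradPoly (n + 1)) = C (1 / 2 : ℝ) * (totalD (totalD (totalD (gradPoly n)))
      + X 0 ^ 2 * totalD (gradPoly n) + X 1 * potPoly n) := by
  rw [gradPoly_succ, Derivation.map_smul, map_add, Derivation.leibniz, totalD_potPoly, totalD_X,
    smul_eq_mul, smul_eq_mul, smul_eq_C_mul]
  ring

theorem isMKdVFlow_totalD_gradPoly (n : ℕ) : IsMKdVFlow n (totalD (gradPoly n)) := by
  induction n with
  | zero => exact totalD_X 0
  | succ n ih =>
    exact ⟨_, potPoly n, ih, totalD_potPoly n, constantCoeff_potPoly n, totalD_gradPoly_succ n⟩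

theorem IsMKdVFlow.eq_totalD_gradPoly {n : ℕ} {f : DiffPoly} (h : IsMKdVFlow n f) :
    f = totalD (gradPoly n) := by
  induction n generalizing f with
  | zero => exact h.trans (totalD_X 0).symm
  | succ n ih =>
    obtain ⟨g, w, hg, hw, hw0, rfl⟩ := h
    obtain rfl := ih hg
    obtain rfl : w = potPoly n := eq_of_totalD_eq (hw.trans (totalD_potPoly n).symm)
      (hw0.trans (constantCoeff_potPoly n).symm)
    exact (totalD_gradPoly_succ n).symm

theorem IsMKdVDensity.two_mul_varDeriv {k : ℕ} {p : DiffPoly} (h : IsMKdVDensity (k + 1) p) :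
    2 * varDeriv p = gradPoly k := by
  obtain ⟨k', hk, -, hc, hflow⟩ := h
  obtain rfl : k = k' := by omega
  refine eq_of_totalD_eq ?_ ?_
  · rw [← hflow.eq_totalD_gradPoly, two_mul, two_mul, map_add]
  · rw [map_mul, hc, mul_zero, constantCoeff_gradPoly]

end MKdVHierarchy

/-! ### Generating functions and the trace identity -/

section CoefficientDerivation

open scoped PowerSeries

variable {R A : Type*} [CommRing R] [CommRing A] [Algebra R A]

/-- The coefficientwise extension of a derivation of `A` to power series over `A`. -/
def coeffDeriv (d : Derivation R A A) : Derivation R A⟦X⟧ A⟦X⟧ :=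
  Derivation.mk'
    { toFun := fun f => PowerSeries.mk fun n => d (PowerSeries.coeff n f)
      map_add' := fun f g => by ext1 n; simp
      map_smul' := fun r f => by ext1 n; simp }
    fun f g => by
      ext1 n
      simp only [LinearMap.coe_mk, AddHom.coe_mk, PowerSeries.coeff_mk, PowerSeries.coeff_mul,
        map_sum, Derivation.leibniz, map_add, smul_eq_mul, Finset.sum_add_distrib]
      congr 1
      exact (Finset.Nat.sum_antidiagonal_swap
        (f := fun i => PowerSeries.coeff i.2 g * d (PowerSeries.coeff i.1 f))).symm

theorem coeff_coeffDeriv (d : Derivation R A A) (f : A⟦X⟧) (n : ℕ) :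
    PowerSeries.coeff n (coeffDeriv d f) = d (PowerSeries.coeff n f) :=
  PowerSeries.coeff_mk n fun n => d (PowerSeries.coeff n f)

theorem coeffDeriv_C (d : Derivation R A A) (a : A) :
    coeffDeriv d (PowerSeries.C a) = PowerSeries.C (d a) := by
  ext1 n
  rw [coeff_coeffDeriv, PowerSeries.coeff_C, PowerSeries.coeff_C, apply_ite d, map_zero]

theorem coeffDeriv_X (d : Derivation R A A) : coeffDeriv d PowerSeries.X = 0 := by
  ext1 n
  rw [coeff_coeffDeriv, PowerSeries.coeff_X, apply_ite d, Derivation.map_one_eq_zero, map_zero,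
    ite_self, map_zero]

theorem coeffDeriv_comm {d₁ d₂ : Derivation R A A} (h : ∀ a, d₁ (d₂ a) = d₂ (d₁ a)) (f : A⟦X⟧) :
    coeffDeriv d₁ (coeffDeriv d₂ f) = coeffDeriv d₂ (coeffDeriv d₁ f) := by
  ext1 n
  simp only [coeff_coeffDeriv, h]

variable (A) in
/-- The Euler derivation `z d/dz` of power series in `z`. -/
def eulerDeriv : Derivation A A⟦X⟧ A⟦X⟧ := (PowerSeries.X : A⟦X⟧) • PowerSeries.derivative A

theorem coeff_eulerDeriv (f : A⟦X⟧) (n : ℕ) :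
    PowerSeries.coeff n (eulerDeriv A f) = n * PowerSeries.coeff n f := by
  rw [eulerDeriv, Derivation.smul_apply, smul_eq_mul]
  cases n with
  | zero => rw [PowerSeries.coeff_zero_X_mul, Nat.cast_zero, zero_mul]
  | succ n => rw [PowerSeries.coeff_succ_X_mul, PowerSeries.coeff_derivative, mul_comm,
      Nat.cast_succ]

theorem eulerDeriv_C (a : A) : eulerDeriv A (PowerSeries.C a) = 0 := by
  rw [eulerDeriv, Derivation.smul_apply, PowerSeries.derivative_C, smul_zero]

theorem eulerDeriv_X : eulerDeriv A PowerSeries.X = PowerSeries.X := by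
  rw [eulerDeriv, Derivation.smul_apply, PowerSeries.derivative_X, smul_eq_mul, mul_one]

theorem coeffDeriv_eulerDeriv (d : Derivation R A A) (f : A⟦X⟧) :
    coeffDeriv d (eulerDeriv A f) = eulerDeriv A (coeffDeriv d f) := by
  ext1 n
  rw [coeff_eulerDeriv, coeff_coeffDeriv, coeff_coeffDeriv, coeff_eulerDeriv, Derivation.leibniz,
    Derivation.map_natCast, smul_zero, add_zero, smul_eq_mul]

/-- The functions `(√z L, z L_s, Q)` solve the spectral problem of the hierarchy. The determinant
consists, up to a power of `z`, of this solution, its variation `δ`, and its derivative `2 θ` in the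
spectral parameter. -/
theorem mul_derivation_det_eq {S B : Type*} [CommRing S] [CommRing B] [Algebra R B] [Algebra S B]
    {D δ : Derivation R B B} {θ : Derivation S B B} {z u L Q : B}
    (hDδ : ∀ f, D (δ f) = δ (D f)) (hDθ : ∀ f, D (θ f) = θ (D f))
    (hDz : D z = 0) (hδz : δ z = 0) (hθz : θ z = z) (hθu : θ u = 0)
    (hL : z * D (D L) = 2 * L - u * Q) (hQ : D Q = z * u * D L)
    (hnorm : Q ^ 2 + z ^ 2 * D L ^ 2 - 2 * z * L ^ 2 = 4) :
    z * D (2 * z * Matrix.det !![L, D L, Q; δ L, δ (D L), δ Q;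
        2 * θ L + L, 2 * θ (D L) + 2 * D L, 2 * θ Q])
      = 8 * (z * δ u * (2 * θ L + L) - δ Q) := by
  have hD2 : D 2 = 0 := Derivation.map_natCast D 2
  have hδ2 : δ 2 = 0 := Derivation.map_natCast δ 2
  have hθ2 : θ 2 = 0 := Derivation.map_natCast θ 2
  have hδ4 : δ 4 = 0 := Derivation.map_natCast δ 4
  have hθ4 : θ 4 = 0 := Derivation.map_natCast θ 4
  have hδL := congrArg δ hL
  have hθL := congrArg θ hL
  have hδnorm := congrArg δ hnorm
  have hθnorm := congrArg θ hnorm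
  simp only [map_sub, map_add, pow_two, Derivation.leibniz, smul_eq_mul, hδ2, hθ2, hδ4, hθ4, hδz,
    hθz, hθu] at hδL hθL hδnorm hθnorm
  simp only [Matrix.det_fin_three, Matrix.of_apply, Matrix.cons_val', Matrix.cons_val_zero,
    Matrix.cons_val_one, Matrix.cons_val, map_sub, map_add, Derivation.leibniz, smul_eq_mul,
    hD2, hDz, hδz, hθz, hθu, hDδ, hDθ, hQ]
  linear_combination 2 * z * (L * (2 * θ Q) - Q * (2 * θ L + L)) * hδL
    + 4 * z * (Q * δ L - L * δ Q) * hθL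
    - 2 * z * (δ L * (2 * θ Q) - δ Q * (2 * θ L + L)) * hL
    + 2 * (z * δ u * (2 * θ L + L) - δ Q) * hnorm
    - 2 * z * δ u * L * hθnorm + Q * hδnorm

end CoefficientDerivation

section TraceIdentity

open MvPolynomial
open scoped PowerSeries

/-- The generating function of the gradients. -/
def gradSeries : DiffPoly⟦X⟧ := PowerSeries.mk gradPoly

/-- The generating function of the nonlocal terms, with the constant of integration that makes the
recursion homogeneous. -/
def potSeries : DiffPoly⟦X⟧ := 2 + PowerSeries.X * PowerSeries.mk potPoly

theorem coeff_ofNat_mul (k n : ℕ) [k.AtLeastTwo] (f : DiffPoly⟦X⟧) :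
    PowerSeries.coeff n (ofNat(k) * f) = ofNat(k) * PowerSeries.coeff n f :=
  PowerSeries.coeff_C_mul n f (OfNat.ofNat k)

theorem X_mul_coeffDeriv_gradSeries :
    PowerSeries.X * coeffDeriv totalD (coeffDeriv totalD gradSeries)
      = 2 * gradSeries - PowerSeries.C (X 0) * potSeries := by
  have hrec : 2 * gradSeries = 2 * PowerSeries.C (X 0) + PowerSeries.X *
      (coeffDeriv totalD (coeffDeriv totalD gradSeries)
        + PowerSeries.C (X 0) * PowerSeries.mk potPoly) := by
    ext1 n
    rw [map_add, coeff_ofNat_mul, coeff_ofNat_mul, gradSeries, PowerSeries.coeff_mk]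
    cases n with
    | zero => rw [PowerSeries.coeff_zero_C, PowerSeries.coeff_zero_X_mul, add_zero, gradPoly_zero]
    | succ n =>
      rw [PowerSeries.coeff_succ_C, mul_zero, zero_add, PowerSeries.coeff_succ_X_mul, map_add,
        coeff_coeffDeriv, coeff_coeffDeriv, PowerSeries.coeff_C_mul, PowerSeries.coeff_mk,
        PowerSeries.coeff_mk, gradPoly_succ, two_mul, ← two_smul ℝ, smul_smul]
      norm_num
  rw [hrec, potSeries]
  ring

theorem coeffDeriv_potSeries (d : Derivation ℝ DiffPoly DiffPoly) :
    coeffDeriv d potSeries = PowerSeries.X * coeffDeriv d (PowerSeries.mk potPoly) := by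
  rw [potSeries, map_add, show coeffDeriv d 2 = 0 from Derivation.map_natCast _ 2,
    Derivation.leibniz, coeffDeriv_X, smul_zero, add_zero, zero_add, smul_eq_mul]

theorem coeffDeriv_totalD_potSeries : coeffDeriv totalD potSeries
    = PowerSeries.X * PowerSeries.C (X 0) * coeffDeriv totalD gradSeries := by
  rw [coeffDeriv_potSeries, mul_assoc]
  congr 1
  ext1 n
  rw [coeff_coeffDeriv, PowerSeries.coeff_mk, totalD_potPoly, PowerSeries.coeff_C_mul,
    coeff_coeffDeriv, gradSeries, PowerSeries.coeff_mk]

theorem eq_of_coeffDeriv_totalD_eq {f g : DiffPoly⟦X⟧}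
    (h : coeffDeriv totalD f = coeffDeriv totalD g)
    (hc : PowerSeries.map constantCoeff f = PowerSeries.map constantCoeff g) : f = g := by
  ext1 n
  refine eq_of_totalD_eq ?_ ?_
  · rw [← coeff_coeffDeriv, h, coeff_coeffDeriv]
  · rw [← PowerSeries.coeff_map, hc, PowerSeries.coeff_map]

theorem potSeries_sq_add_eq_four :
    potSeries ^ 2 + PowerSeries.X ^ 2 * coeffDeriv totalD gradSeries ^ 2
      - 2 * PowerSeries.X * gradSeries ^ 2 = 4 := by
  have hD2 : coeffDeriv totalD 2 = 0 := Derivation.map_natCast _ 2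
  have hD4 : coeffDeriv totalD 4 = 0 := Derivation.map_natCast _ 4
  refine eq_of_coeffDeriv_totalD_eq ?_ ?_
  · simp only [map_add, map_sub, pow_two, Derivation.leibniz, smul_eq_mul, coeffDeriv_X, hD2, hD4,
      coeffDeriv_totalD_potSeries]
    linear_combination 2 * PowerSeries.X * coeffDeriv totalD gradSeries *
      X_mul_coeffDeriv_gradSeries
  · have hgrad : PowerSeries.map constantCoeff gradSeries = 0 := by
      ext1 n
      rw [PowerSeries.coeff_map, gradSeries, PowerSeries.coeff_mk, constantCoeff_gradPoly, map_zero]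
    have hDgrad : PowerSeries.map constantCoeff (coeffDeriv totalD gradSeries) = 0 := by
      ext1 n
      rw [PowerSeries.coeff_map, coeff_coeffDeriv, constantCoeff_totalD, map_zero]
    have hpot : PowerSeries.map constantCoeff (PowerSeries.mk potPoly) = 0 := by
      ext1 n
      rw [PowerSeries.coeff_map, PowerSeries.coeff_mk, constantCoeff_potPoly, map_zero]
    rw [potSeries]
    simp only [map_add, map_sub, map_mul, map_pow, hgrad, hDgrad, hpot, map_ofNat]
    norm_num

theorem trace_identity (v : DiffPoly) :
    ∃ f : DiffPoly⟦X⟧, coeffDeriv totalD f =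
      8 * (PowerSeries.C v * (2 * eulerDeriv DiffPoly gradSeries + gradSeries)
        - coeffDeriv (evolD v) (PowerSeries.mk potPoly)) := by
  have hdet := mul_derivation_det_eq (coeffDeriv_comm fun p => (evolD_totalD v p).symm)
    (coeffDeriv_eulerDeriv totalD) (coeffDeriv_X totalD) (coeffDeriv_X (evolD v)) eulerDeriv_X
    (eulerDeriv_C (X 0)) X_mul_coeffDeriv_gradSeries coeffDeriv_totalD_potSeries
    potSeries_sq_add_eq_four
  refine ⟨_, mul_left_cancel₀ PowerSeries.X_ne_zero (hdet.trans ?_)⟩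
  rw [coeffDeriv_C, evolD_X, Function.iterate_zero_apply, coeffDeriv_potSeries]
  ring

theorem evolD_potPoly_sub_mem_exactPolys (v : DiffPoly) (n : ℕ) :
    evolD v (potPoly n) - (2 * n + 1 : ℝ) • gradPoly n * v ∈ exactPolys := by
  obtain ⟨f, hf⟩ := trace_identity v
  have hn := congrArg (PowerSeries.coeff n) hf
  rw [coeff_coeffDeriv, coeff_ofNat_mul, map_sub, PowerSeries.coeff_C_mul, map_add, coeff_ofNat_mul,
    coeff_eulerDeriv, coeff_coeffDeriv, PowerSeries.coeff_mk, gradSeries,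
    PowerSeries.coeff_mk] at hn
  refine (exactPolys.smul_mem_iff (s := (-8 : ℝ)) (by norm_num)).mp
    (mem_exactPolys.mpr ⟨_, hn.trans ?_⟩)
  rw [smul_eq_C_mul, smul_eq_C_mul]
  simp only [map_neg, map_add, map_mul, map_ofNat, map_natCast, map_one]
  ring

theorem varDeriv_smul_potPoly (n : ℕ) (a : ℝ) :
    varDeriv (a • potPoly n) = (a * (2 * n + 1)) • gradPoly n := by
  refine varDeriv_eq_of_forall_mem_exactPolys fun v => ?_
  rw [Derivation.map_smul, mul_smul, smul_mul_assoc, ← smul_sub]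
  exact exactPolys.smul_mem a (evolD_potPoly_sub_mem_exactPolys v n)

theorem exists_isMKdVDensity (n : ℕ) (hn : 1 ≤ n) : ∃ p, IsMKdVDensity n p := by
  obtain ⟨k, rfl⟩ := Nat.exists_eq_add_of_le' hn
  have hvar : varDeriv ((1 / (2 * (2 * k + 1)) : ℝ) • potPoly k) = (1 / 2 : ℝ) • gradPoly k := by
    rw [varDeriv_smul_potPoly]
    congr 1
    field_simp
  refine ⟨(1 / (2 * (2 * k + 1)) : ℝ) • potPoly k, k, rfl, ?_, ?_, ?_⟩
  · rw [constantCoeff_smul, constantCoeff_potPoly, smul_zero]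
  · rw [hvar, constantCoeff_smul, constantCoeff_gradPoly, smul_zero]
  · rw [hvar, Derivation.map_smul, two_mul, ← add_smul, add_halves, one_smul]
    exact isMKdVFlow_totalD_gradPoly k

end TraceIdentity

/-! ### Smooth functions on the circle -/

section SmoothPeriodic

open scoped Real

/-- Smooth functions on `S¹ = ℝ / 2πℤ` with values in a normed space. -/
def IsSmoothPer {E : Type*} [NormedAddCommGroup E] [NormedSpace ℝ E] (f : ℝ → E) : Prop :=
  ContDiff ℝ ∞ f ∧ Function.Periodic f (2 * π)

namespace IsSmoothPer

variable {E : Type*} [NormedAddCommGroup E] [NormedSpace ℝ E] {f g : ℝ → E}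

protected theorem hasDerivAt (hf : IsSmoothPer f) (s : ℝ) : HasDerivAt f (deriv f s) s :=
  (hf.1.differentiable (by simp) s).hasDerivAt

protected theorem continuous (hf : IsSmoothPer f) : Continuous f := hf.1.continuous

protected theorem intervalIntegrable (hf : IsSmoothPer f) (a b : ℝ) :
    IntervalIntegrable f MeasureTheory.volume a b :=
  hf.continuous.intervalIntegrable a b

protected theorem deriv (hf : IsSmoothPer f) : IsSmoothPer (deriv f) :=
  ⟨(contDiff_infty_iff_deriv.mp hf.1).2, fun s => by
    rw [← deriv_comp_add_const]
    congr 1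
    exact funext hf.2⟩

protected theorem iteratedDeriv (hf : IsSmoothPer f) (j : ℕ) : IsSmoothPer (iteratedDeriv j f) := by
  induction j with
  | zero => rwa [iteratedDeriv_zero]
  | succ j ih =>
    rw [iteratedDeriv_succ]
    exact ih.deriv

protected theorem const (c : E) : IsSmoothPer fun _ : ℝ => c := ⟨contDiff_const, fun _ => rfl⟩

protected theorem add (hf : IsSmoothPer f) (hg : IsSmoothPer g) : IsSmoothPer fun s => f s + g s :=
  ⟨hf.1.add hg.1, hf.2.add hg.2⟩

protected theorem sub (hf : IsSmoothPer f) (hg : IsSmoothPer g) : IsSmoothPer fun s => f s - g s :=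
  ⟨hf.1.sub hg.1, hf.2.sub hg.2⟩

protected theorem mul {A : Type*} [NormedRing A] [NormedAlgebra ℝ A] {f g : ℝ → A}
    (hf : IsSmoothPer f) (hg : IsSmoothPer g) : IsSmoothPer fun s => f s * g s :=
  ⟨hf.1.mul hg.1, hf.2.mul hg.2⟩

protected theorem const_mul {A : Type*} [NormedRing A] [NormedAlgebra ℝ A] {f : ℝ → A}
    (hf : IsSmoothPer f) (c : A) : IsSmoothPer fun s => c * f s :=
  (IsSmoothPer.const c).mul hf

protected theorem ofReal {f : ℝ → ℝ} (hf : IsSmoothPer f) : IsSmoothPer fun s => (f s : ℂ) :=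
  ⟨Complex.ofRealCLM.contDiff.comp hf.1, hf.2.comp Complex.ofReal⟩

theorem hasDerivAt_ofReal {f : ℝ → ℝ} (hf : IsSmoothPer f) (s : ℝ) :
    HasDerivAt (fun s => (f s : ℂ)) ((deriv f s : ℝ) : ℂ) s :=
  (hf.hasDerivAt s).ofReal_comp

protected theorem comp_add (hf : IsSmoothPer f) (σ : ℝ) : IsSmoothPer fun s => f (s + σ) :=
  ⟨hf.1.comp (contDiff_id.add contDiff_const),
    fun s => by simp only [add_right_comm s (2 * π) σ, hf.2 (s + σ)]⟩

theorem deriv_const_mul_add {A : Type*} [NormedRing A] [NormedAlgebra ℝ A] {f g : ℝ → A}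
    (hf : IsSmoothPer f) (hg : IsSmoothPer g) (c : A) :
    deriv (fun s => c * f s + g s) = fun s => c * deriv f s + deriv g s :=
  funext fun s => (((hf.hasDerivAt s).const_mul c).add (hg.hasDerivAt s)).deriv

theorem integral_comp_add (hf : IsSmoothPer f) (σ : ℝ) :
    ∫ s in 0..2 * π, f (s + σ) = ∫ s in 0..2 * π, f s := by
  rw [intervalIntegral.integral_comp_add_right, zero_add, add_comm (2 * π),
    hf.2.intervalIntegral_add_eq σ 0, zero_add]

theorem integral_deriv [CompleteSpace E] (hf : IsSmoothPer f) :
    ∫ s in 0..2 * π, deriv f s = 0 := by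
  rw [intervalIntegral.integral_deriv_eq_sub (fun s _ => (hf.hasDerivAt s).differentiableAt)
    (hf.deriv.intervalIntegrable _ _), hf.2.eq, sub_self]

theorem integral_eq_of_hasDerivAt_sub [CompleteSpace E] {F : ℝ → E} (hf : IsSmoothPer f)
    (hg : IsSmoothPer g) (hF : IsSmoothPer F) (h : ∀ s, HasDerivAt F (f s - g s) s) :
    ∫ s in 0..2 * π, f s = ∫ s in 0..2 * π, g s := by
  rw [← sub_eq_zero, ← intervalIntegral.integral_sub (hf.intervalIntegrable _ _)
    (hg.intervalIntegrable _ _), ← hF.integral_deriv]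
  simp only [(h _).deriv]

theorem integral_mul_deriv {A : Type*} [NormedRing A] [NormedAlgebra ℝ A] [CompleteSpace A]
    {f g : ℝ → A} (hf : IsSmoothPer f) (hg : IsSmoothPer g) :
    ∫ s in 0..2 * π, f s * deriv g s = -∫ s in 0..2 * π, deriv f s * g s := by
  rw [intervalIntegral.integral_mul_deriv_eq_deriv_mul (fun s _ => hf.hasDerivAt s)
    (fun s _ => hg.hasDerivAt s) (hf.deriv.intervalIntegrable _ _)
    (hg.deriv.intervalIntegrable _ _), hf.2.eq, hg.2.eq, sub_self, zero_sub]

theorem exists_primitive [CompleteSpace E] (hf : IsSmoothPer f) (h : ∫ s in 0..2 * π, f s = 0) :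
    ∃ F : ℝ → E, IsSmoothPer F ∧ deriv F = f := by
  have hd : ∀ s, HasDerivAt (fun s => ∫ x in (0 : ℝ)..s, f x) (f s) s := fun s =>
    hf.continuous.integral_hasStrictDerivAt 0 s |>.hasDerivAt
  have hderiv : deriv (fun s => ∫ x in (0 : ℝ)..s, f x) = f := funext fun s => (hd s).deriv
  refine ⟨fun s => ∫ x in (0 : ℝ)..s, f x, ⟨?_, fun s => ?_⟩, hderiv⟩
  · exact contDiff_infty_iff_deriv.mpr ⟨fun s => (hd s).differentiableAt, hderiv.symm ▸ hf.1⟩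
  · have hperiod : ∫ x in s..s + 2 * π, f x = 0 := by
      rw [hf.2.intervalIntegral_add_eq s 0, zero_add, h]
    simp only
    rw [← intervalIntegral.integral_add_adjacent_intervals (hf.intervalIntegrable 0 s)
      (hf.intervalIntegrable s _), hperiod, add_zero]

end IsSmoothPer

end SmoothPeriodic

/-! ### Lenard chains -/

section LenardChains

open scoped Real

variable {κ : ℝ → ℂ} {m : ℕ}

/-- The operator `½ D_s³ + 2 κ D_s + κ_s`, which is `Ω D_s` for the recursion operator `Ω` of the
KdV equation. It contains no primitives. -/
def lenard (κ q : ℝ → ℂ) (s : ℝ) : ℂ :=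
  (1 / 2 : ℂ) * deriv (deriv (deriv q)) s + 2 * κ s * deriv q s + deriv κ s * q s

protected theorem IsSmoothPer.lenard {q : ℝ → ℂ} (hκ : IsSmoothPer κ) (hq : IsSmoothPer q) :
    IsSmoothPer (lenard κ q) :=
  ((hq.deriv.deriv.deriv.const_mul _).add ((hκ.const_mul 2).mul hq.deriv)).add (hκ.deriv.mul hq)

theorem lenard_mul_add {p q : ℝ → ℂ} (r : ℂ) (hp : IsSmoothPer p) (hq : IsSmoothPer q) :
    lenard κ (fun s => r * p s + q s) = fun s => r * lenard κ p s + lenard κ q s := by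
  funext s
  simp only [lenard]
  rw [hp.deriv_const_mul_add hq, hp.deriv.deriv_const_mul_add hq.deriv,
    hp.deriv.deriv.deriv_const_mul_add hq.deriv.deriv]
  ring

theorem lenard_comp_add (κ q : ℝ → ℂ) (σ s : ℝ) :
    lenard (fun s => κ (s + σ)) (fun s => q (s + σ)) s = lenard κ q (s + σ) := by
  have hd (f : ℝ → ℂ) : (deriv fun s => f (s + σ)) = fun s => deriv f (s + σ) :=
    funext fun s => deriv_comp_add_const f σ s
  simp only [lenard, hd]

theorem integral_mul_lenard {p q : ℝ → ℂ} (hκ : IsSmoothPer κ) (hp : IsSmoothPer p)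
    (hq : IsSmoothPer q) :
    ∫ s in 0..2 * π, p s * lenard κ q s = -∫ s in 0..2 * π, lenard κ p s * q s := by
  rw [← intervalIntegral.integral_neg]
  refine IsSmoothPer.integral_eq_of_hasDerivAt_sub (hp.mul (hκ.lenard hq))
    (F := fun s => (1 / 2 : ℂ) * (p s * deriv (deriv q) s - deriv p s * deriv q s
      + deriv (deriv p) s * q s) + 2 * κ s * (p s * q s)) ?_ ?_ fun s => ?_
  · simpa only [neg_one_mul] using ((hκ.lenard hp).mul hq).const_mul (-1)
  · exact ((((hp.mul hq.deriv.deriv).sub (hp.deriv.mul hq.deriv)).add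
      (hp.deriv.deriv.mul hq)).const_mul _).add ((hκ.const_mul 2).mul (hp.mul hq))
  · refine (((((hp.hasDerivAt s).mul (hq.deriv.deriv.hasDerivAt s)).sub
      ((hp.deriv.hasDerivAt s).mul (hq.deriv.hasDerivAt s))).add
      ((hp.deriv.deriv.hasDerivAt s).mul (hq.hasDerivAt s))).const_mul (1 / 2 : ℂ)).add
      (((hκ.hasDerivAt s).const_mul 2).mul ((hp.hasDerivAt s).mul (hq.hasDerivAt s)))
      |>.congr_deriv ?_
    simp only [lenard, Pi.mul_apply]
    ring

/-- Functions `q 0, …, q k` on the circle with `D_s (q (j + 1)) = (½ D_s³ + 2 κ D_s + κ_s) (q j)`.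
Thus `D_s (q j) = Ω^j D_s (q 0)`, and the choice of the primitives in these iterates is the choice
of the `q j`. -/
structure IsLenardChain (κ : ℝ → ℂ) (k : ℕ) (q : ℕ → ℝ → ℂ) : Prop where
  circle : ∀ j ≤ k, IsSmoothPer (q j)
  step : ∀ j < k, deriv (q (j + 1)) = lenard κ (q j)

namespace IsLenardChain

variable {p q : ℕ → ℝ → ℂ}

theorem zero (hq : IsSmoothPer (q 0)) : IsLenardChain κ 0 q :=
  ⟨fun j hj => by rwa [Nat.le_zero.mp hj], fun _ hj => absurd hj (Nat.not_lt_zero _)⟩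

theorem extend {r : ℝ → ℂ} (hq : IsLenardChain κ m q) (hr : IsSmoothPer r)
    (h : deriv r = lenard κ (q m)) : IsLenardChain κ (m + 1) (Function.update q (m + 1) r) := by
  refine ⟨fun j hj => ?_, fun j hj => ?_⟩
  · rcases hj.eq_or_lt with rfl | hj
    · rwa [Function.update_self]
    · rw [Function.update_of_ne hj.ne]
      exact hq.circle j (Nat.le_of_lt_succ hj)
  · rw [Function.update_of_ne hj.ne]
    rcases (Nat.le_of_lt_succ hj).eq_or_lt with rfl | hj
    · rwa [Function.update_self]
    · rw [Function.update_of_ne (by omega)]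
      exact hq.step j hj

theorem mul_add (r : ℂ) (hp : IsLenardChain κ m p) (hq : IsLenardChain κ m q) :
    IsLenardChain κ m fun j s => r * p j s + q j s := by
  refine ⟨fun j hj => ((hp.circle j hj).const_mul r).add (hq.circle j hj), fun j hj => ?_⟩
  rw [(hp.circle _ hj).deriv_const_mul_add (hq.circle _ hj), hp.step j hj, hq.step j hj,
    lenard_mul_add r (hp.circle j hj.le) (hq.circle j hj.le)]

theorem comp_add (hq : IsLenardChain κ m q) (σ : ℝ) :
    IsLenardChain (fun s => κ (s + σ)) m fun j s => q j (s + σ) :=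
  ⟨fun j hj => (hq.circle j hj).comp_add σ, fun j hj => funext fun s => by
    rw [lenard_comp_add, ← hq.step j hj, deriv_comp_add_const]⟩

theorem integral_mul_lenard_comm (hκ : IsSmoothPer κ) (hp : IsLenardChain κ m p)
    (hq : IsLenardChain κ m q) :
    ∫ s in 0..2 * π, p 0 s * lenard κ (q m) s = ∫ s in 0..2 * π, p m s * lenard κ (q 0) s := by
  have move : ∀ j ≤ m, ∫ s in 0..2 * π, p 0 s * lenard κ (q m) s =
      ∫ s in 0..2 * π, p j s * lenard κ (q (m - j)) s := by
    intro j
    induction j with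
    | zero => intro _; rfl
    | succ j ih =>
      intro hj
      have hqj := hq.step (m - (j + 1)) (by omega)
      rw [show m - (j + 1) + 1 = m - j by omega] at hqj
      rw [ih (by omega), integral_mul_lenard hκ (hp.circle j (by omega)) (hq.circle _ (by omega)),
        ← hp.step j hj, ← hqj,
        (hp.circle _ hj).integral_mul_deriv (hq.circle _ (by omega))]
  simpa only [Nat.sub_self] using move m le_rfl

protected theorem isOmegaIterates (hq : IsLenardChain κ m q) :
    IsOmegaIterates κ (q 0) (m + 1) q
      (Function.update (fun j => deriv (q j)) (m + 1) (lenard κ (q m))) := by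
  refine ⟨rfl, Function.update_of_ne (by omega) _ _, fun j hj => hq.circle j (by omega),
    fun j hj => by rw [Function.update_of_ne hj.ne], fun j hj s => ?_⟩
  rw [Function.update_of_ne hj.ne]
  rcases (Nat.le_of_lt_succ hj).eq_or_lt with rfl | hj
  · rw [Function.update_self, lenard]
  · rw [Function.update_of_ne (by omega), hq.step j hj, lenard]

end IsLenardChain

theorem IsOmegaIterates.eq_lenard {β : ℝ → ℂ} {k : ℕ} {a b : ℕ → ℝ → ℂ}
    (h : IsOmegaIterates κ β k a b) {j : ℕ} (hj : j < k) : b (j + 1) = lenard κ (a j) :=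
  funext fun s => by rw [h.step j hj, ← h.primitive j hj, lenard]

theorem IsOmegaIterates.isLenardChain {β : ℝ → ℂ} {a b : ℕ → ℝ → ℂ}
    (h : IsOmegaIterates κ β (m + 1) a b) : IsLenardChain κ m a :=
  ⟨fun j hj => h.circle j (by omega), fun j hj => by
    rw [h.primitive (j + 1) (by omega), h.eq_lenard (by omega)]⟩

/-- `α` is the first member of a Lenard chain, i.e. `D_s⁻¹ Ω^j α_s` exists on the circle for
`j ≤ k`. -/
def HasLenardChain (κ : ℝ → ℂ) (k : ℕ) (α : ℝ → ℂ) : Prop :=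
  ∃ q, IsLenardChain κ k q ∧ q 0 = α

open Classical in
/-- The pairing `∫ α Ω^(m+1) β_s ds` of functions on the circle. The primitives are chosen
arbitrarily, and the value is `0` if they do not exist; see `kdvForm_eq` for the independence of the
choice. -/
def kdvForm (κ : ℝ → ℂ) (m : ℕ) (α β : ℝ → ℂ) : ℂ :=
  if h : HasLenardChain κ m β then ∫ s in 0..2 * π, α s * lenard κ (h.choose m) s else 0

theorem kdvForm_eq {q : ℕ → ℝ → ℂ} {α : ℝ → ℂ} (hκ : IsSmoothPer κ) (hα : HasLenardChain κ m α)
    (hq : IsLenardChain κ m q) :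
    kdvForm κ m α (q 0) = ∫ s in 0..2 * π, α s * lenard κ (q m) s := by
  obtain ⟨p, hp, rfl⟩ := hα
  have hex : HasLenardChain κ m (q 0) := ⟨q, hq, rfl⟩
  rw [kdvForm, dif_pos hex, hp.integral_mul_lenard_comm hκ hex.choose_spec.1,
    hp.integral_mul_lenard_comm hκ hq, hex.choose_spec.2]

theorem kdvForm_antisymm {α β : ℝ → ℂ} (hκ : IsSmoothPer κ) (hα : HasLenardChain κ m α)
    (hβ : HasLenardChain κ m β) : kdvForm κ m α β = -kdvForm κ m β α := by
  obtain ⟨p, hp, rfl⟩ := id hα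
  obtain ⟨q, hq, rfl⟩ := id hβ
  rw [kdvForm_eq hκ hα hq, kdvForm_eq hκ hβ hp, hp.integral_mul_lenard_comm hκ hq,
    integral_mul_lenard hκ (hp.circle m le_rfl) (hq.circle 0 (Nat.zero_le _))]
  simp only [mul_comm]

theorem kdvForm_mul_add {α β₁ β₂ : ℝ → ℂ} (r : ℂ) (hκ : IsSmoothPer κ)
    (hα : HasLenardChain κ m α) (h₁ : HasLenardChain κ m β₁) (h₂ : HasLenardChain κ m β₂) :
    kdvForm κ m α (fun s => r * β₁ s + β₂ s) = r * kdvForm κ m α β₁ + kdvForm κ m α β₂ := by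
  obtain ⟨p, hp, rfl⟩ := id hα
  obtain ⟨q₁, hq₁, rfl⟩ := h₁
  obtain ⟨q₂, hq₂, rfl⟩ := h₂
  have hint {q : ℕ → ℝ → ℂ} (hq : IsLenardChain κ m q) :
      IsSmoothPer fun s => p 0 s * lenard κ (q m) s :=
    (hp.circle 0 (Nat.zero_le _)).mul (hκ.lenard (hq.circle m le_rfl))
  rw [kdvForm_eq hκ hα (hq₁.mul_add r hq₂), kdvForm_eq hκ hα hq₁, kdvForm_eq hκ hα hq₂,
    lenard_mul_add r (hq₁.circle m le_rfl) (hq₂.circle m le_rfl),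
    ← intervalIntegral.integral_const_mul, ← intervalIntegral.integral_add
      (((hint hq₁).intervalIntegrable _ _).const_mul r) ((hint hq₂).intervalIntegrable _ _)]
  simp only [mul_add, mul_left_comm]

theorem kdvForm_comp_add {α β : ℝ → ℂ} (hκ : IsSmoothPer κ) (hα : HasLenardChain κ m α)
    (hβ : HasLenardChain κ m β) (σ : ℝ) :
    kdvForm (fun s => κ (s + σ)) m (fun s => α (s + σ)) (fun s => β (s + σ)) =
      kdvForm κ m α β := by
  obtain ⟨p, hp, rfl⟩ := id hα
  obtain ⟨q, hq, rfl⟩ := hβ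
  rw [kdvForm_eq hκ hα hq, kdvForm_eq (hκ.comp_add σ) ⟨_, hp.comp_add σ, rfl⟩ (hq.comp_add σ),
    ← ((hp.circle 0 (Nat.zero_le _)).mul (hκ.lenard (hq.circle m le_rfl))).integral_comp_add σ]
  simp only [lenard_comp_add]

end LenardChains

/-! ### The Miura transformation -/

section Miura

open Complex
open scoped Real

variable {u : ℝ → ℝ}

/-- The Miura transformation `u ↦ u² / 4 + i u_s / 2`, which maps the curvature of a curve to the
equicentroaffine curvature of its image under `Φ`. -/
def miuraCurv (u : ℝ → ℝ) (s : ℝ) : ℂ :=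
  (1 / 4 : ℂ) * ((u s : ℂ) * (u s : ℂ)) + (1 / 2 : ℂ) * (I * ((deriv u s : ℝ) : ℂ))

protected theorem IsSmoothPer.miuraCurv (hu : IsSmoothPer u) : IsSmoothPer (miuraCurv u) :=
  ((hu.ofReal.mul hu.ofReal).const_mul _).add ((hu.deriv.ofReal.const_mul _).const_mul _)

theorem miuraCurv_comp_add (σ : ℝ) (u : ℝ → ℝ) :
    miuraCurv (fun s => u (s + σ)) = fun s => miuraCurv u (s + σ) := by
  funext s
  simp only [miuraCurv, deriv_comp_add_const]

theorem deriv_miuraCurv (hu : IsSmoothPer u) (s : ℝ) :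
    deriv (miuraCurv u) s =
      (1 / 2 : ℂ) * (u s * (deriv u s : ℝ) + I * (deriv (deriv u) s : ℝ)) := by
  have h := (((hu.hasDerivAt_ofReal s).mul (hu.hasDerivAt_ofReal s)).const_mul (1 / 4 : ℂ)).add
    (((hu.deriv.hasDerivAt_ofReal s).const_mul I).const_mul (1 / 2 : ℂ))
  rw [show deriv (miuraCurv u) s = _ from h.deriv]
  ring

/-- `q_s + i u q = i l` with a real function `l`: the deformation of a curve with curvature `u` and
tangent `T` whose velocity is `q T` rotates the tangent with angular velocity `l`. -/
structure IsRotation (u : ℝ → ℝ) (q : ℝ → ℂ) (l : ℝ → ℝ) : Prop where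
  circle : IsSmoothPer q
  real_circle : IsSmoothPer l
  deriv_eq : ∀ s, deriv q s = I * l s - I * (u s * q s)

/-- The function `(w + i l_s) / 2`. If `w` is a primitive of `u l_s` and `q` rotates with angular
velocity `l`, it is the successor of `q` in a Lenard chain. -/
def nextVelocity (l w : ℝ → ℝ) (s : ℝ) : ℂ := (1 / 2 : ℂ) * (w s + I * deriv l s)

namespace IsRotation

variable {p q : ℝ → ℂ} {k l w : ℝ → ℝ}

theorem deriv_deriv (hu : IsSmoothPer u) (h : IsRotation u q l) (s : ℝ) :
    deriv (deriv q) s = I * deriv l s - I * (deriv u s * q s + u s * deriv q s) := by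
  conv_lhs => rw [show deriv q = _ from funext h.deriv_eq]
  exact (((h.real_circle.hasDerivAt_ofReal s).const_mul I).sub
    (((hu.hasDerivAt_ofReal s).mul (h.circle.hasDerivAt s)).const_mul I)).deriv

theorem deriv_deriv_deriv (hu : IsSmoothPer u) (h : IsRotation u q l) (s : ℝ) :
    deriv (deriv (deriv q)) s = I * deriv (deriv l) s -
      I * (deriv (deriv u) s * q s + 2 * (deriv u s * deriv q s) + u s * deriv (deriv q) s) := by
  conv_lhs => rw [show deriv (deriv q) = _ from funext (h.deriv_deriv hu)]
  refine ((((h.real_circle.deriv.hasDerivAt_ofReal s).const_mul I).sub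
    ((((hu.deriv.hasDerivAt_ofReal s).mul (h.circle.hasDerivAt s)).add
      ((hu.hasDerivAt_ofReal s).mul (h.circle.deriv.hasDerivAt s))).const_mul I))
    |>.congr_deriv ?_).deriv
  ring

theorem lenard_eq (hu : IsSmoothPer u) (h : IsRotation u q l) (s : ℝ) :
    lenard (miuraCurv u) q s = (1 / 2 : ℂ) * (u s * deriv l s + I * deriv (deriv l) s) := by
  rw [lenard, h.deriv_deriv_deriv hu, h.deriv_deriv hu, deriv_miuraCurv hu, miuraCurv]
  linear_combination
    (1 / 2 * u s * (deriv u s * q s + u s * deriv q s - (deriv l s : ℝ)) : ℂ) * I_sq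

theorem integral_mul_lenard (hu : IsSmoothPer u) (hp : IsRotation u p k) (hq : IsRotation u q l) :
    ∫ s in 0..2 * π, p s * lenard (miuraCurv u) q s =
      ((1 / 2 * ∫ s in 0..2 * π, k s * deriv l s : ℝ) : ℂ) := by
  have hk := (hp.real_circle.mul hq.real_circle.deriv).ofReal.const_mul (1 / 2)
  calc
    _ = ∫ s in 0..2 * π, (1 / 2 : ℂ) * ((k s * deriv l s : ℝ) : ℂ) := by
      refine IsSmoothPer.integral_eq_of_hasDerivAt_sub (F := fun s => I / 2 * (p s * deriv l s))
        (hp.circle.mul (hu.miuraCurv.lenard hq.circle)) hk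
        ((hp.circle.mul hq.real_circle.deriv.ofReal).const_mul _) fun s => ?_
      refine (((hp.circle.hasDerivAt s).mul
        (hq.real_circle.deriv.hasDerivAt_ofReal s)).const_mul (I / 2)).congr_deriv ?_
      rw [hq.lenard_eq hu, hp.deriv_eq]
      push_cast
      linear_combination (1 / 2 * (k s - u s * p s) * (deriv l s : ℝ) : ℂ) * I_sq
    _ = _ := by
      rw [intervalIntegral.integral_const_mul, intervalIntegral.integral_ofReal]
      push_cast
      rfl

theorem deriv_nextVelocity (hu : IsSmoothPer u) (h : IsRotation u q l) (hw : IsSmoothPer w)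
    (hwl : deriv w = fun s => u s * deriv l s) :
    deriv (nextVelocity l w) = lenard (miuraCurv u) q := by
  funext s
  have hd := ((hw.hasDerivAt_ofReal s).add
    ((h.real_circle.deriv.hasDerivAt_ofReal s).const_mul I)).const_mul (1 / 2 : ℂ)
  rw [h.lenard_eq hu, ← ofReal_mul, ← congrFun hwl s]
  exact hd.deriv

theorem nextVelocity (hu : IsSmoothPer u) (h : IsRotation u q l) (hw : IsSmoothPer w)
    (hwl : deriv w = fun s => u s * deriv l s) :
    IsRotation u (nextVelocity l w) fun s => 1 / 2 * (deriv (deriv l) s + u s * w s) where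
  circle := (hw.ofReal.add (h.real_circle.deriv.ofReal.const_mul _)).const_mul _
  real_circle := (h.real_circle.deriv.deriv.add (hu.mul hw)).const_mul _
  deriv_eq s := by
    rw [h.deriv_nextVelocity hu hw hwl, h.lenard_eq hu, ClosedCurves.nextVelocity]
    push_cast
    linear_combination (1 / 2 * u s * (deriv l s : ℝ) : ℂ) * I_sq

end IsRotation

end Miura

/-! ### Evaluation of differential polynomials -/

section Evaluation

open MvPolynomial

variable {u : ℝ → ℝ}

/-- The function `p(u, u_s, u_ss, …)`. -/
def evalDiff (u : ℝ → ℝ) (p : DiffPoly) (s : ℝ) : ℝ :=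
  eval (fun j : ℕ => iteratedDeriv j u s) p

protected theorem IsSmoothPer.evalDiff (hu : IsSmoothPer u) (p : DiffPoly) :
    IsSmoothPer (evalDiff u p) := by
  unfold evalDiff
  induction p using MvPolynomial.induction_on with
  | C a => simpa only [eval_C] using IsSmoothPer.const a
  | add p q hp hq => simpa only [map_add] using hp.add hq
  | mul_X p i hp => simpa only [map_mul, eval_X] using hp.mul (hu.iteratedDeriv i)

theorem deriv_evalDiff (hu : IsSmoothPer u) (p : DiffPoly) :
    deriv (evalDiff u p) = evalDiff u (totalD p) :=
  funext fun s => (hasDerivAt_eval_of_forall_X totalD (f := fun s j => iteratedDeriv j u s)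
    (fun j => by
      rw [totalD_X, eval_X, iteratedDeriv_succ]
      exact (hu.iteratedDeriv j).hasDerivAt s) p).deriv

end Evaluation

/-! ### Deformations along the level sets -/

section LevelTangent

open scoped Real

variable {u : ℝ → ℝ}

theorem evalDiff_gradPoly_zero (u : ℝ → ℝ) : evalDiff u (gradPoly 0) = u := by
  funext s
  simp [evalDiff, gradPoly_zero]

theorem deriv_evalDiff_potPoly (hu : IsSmoothPer u) (j : ℕ) :
    deriv (evalDiff u (potPoly j)) = fun s => u s * deriv (evalDiff u (gradPoly j)) s := by
  funext s
  rw [deriv_evalDiff hu, deriv_evalDiff hu, totalD_potPoly]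
  simp [evalDiff]

theorem evalDiff_gradPoly_succ (hu : IsSmoothPer u) (j : ℕ) :
    evalDiff u (gradPoly (j + 1)) = fun s =>
      1 / 2 * (deriv (deriv (evalDiff u (gradPoly j))) s + u s * evalDiff u (potPoly j) s) := by
  funext s
  rw [deriv_evalDiff hu, deriv_evalDiff hu, gradPoly_succ]
  simp [evalDiff, mul_add]

/-- The Lenard chain that starts at the constant function `1`, i.e. at the rotation of the
parameter. Its primitives are given by differential polynomials. -/
def shiftChain (u : ℝ → ℝ) : ℕ → ℝ → ℂ
  | 0 => fun _ => 1
  | j + 1 => nextVelocity (evalDiff u (gradPoly j)) (evalDiff u (potPoly j))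

theorem isRotation_shiftChain (hu : IsSmoothPer u) (j : ℕ) :
    IsRotation u (shiftChain u j) (evalDiff u (gradPoly j)) := by
  induction j with
  | zero => exact ⟨.const 1, hu.evalDiff _, fun s => by
      simp [shiftChain, evalDiff_gradPoly_zero]⟩
  | succ j ih =>
    rw [evalDiff_gradPoly_succ hu]
    exact ih.nextVelocity hu (hu.evalDiff _) (deriv_evalDiff_potPoly hu j)

theorem isLenardChain_shiftChain (hu : IsSmoothPer u) (m : ℕ) :
    IsLenardChain (miuraCurv u) m (shiftChain u) :=
  ⟨fun j _ => (isRotation_shiftChain hu j).circle, fun j _ =>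
    (isRotation_shiftChain hu j).deriv_nextVelocity hu (hu.evalDiff _)
      (deriv_evalDiff_potPoly hu j)⟩

theorem IsLenardChain.integral_shiftChain_mul_lenard {m : ℕ} {q : ℕ → ℝ → ℂ} {l : ℝ → ℝ}
    (hu : IsSmoothPer u) (hq : IsLenardChain (miuraCurv u) m q) (h : IsRotation u (q 0) l) :
    ∫ s in 0..2 * π, shiftChain u 0 s * lenard (miuraCurv u) (q m) s =
      ((1 / 2 * ∫ s in 0..2 * π, evalDiff u (gradPoly m) s * deriv l s : ℝ) : ℂ) :=
  ((isLenardChain_shiftChain hu m).integral_mul_lenard_comm hu.miuraCurv hq).trans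
    ((isRotation_shiftChain hu m).integral_mul_lenard hu h)

/-- `q` is an infinitesimal deformation of a closed curve with curvature `u` (see `IsRotation`) that
preserves the first `m` Hamiltonians of the modified KdV hierarchy. Here `gradPoly j` is twice the
gradient of the `(j + 1)`-st Hamiltonian and `l_s` is the variation of `u`. -/
def IsLevelTangent (u : ℝ → ℝ) (m : ℕ) (q : ℝ → ℂ) : Prop :=
  ∃ l, IsRotation u q l ∧ ∀ j < m, ∫ s in 0..2 * π, evalDiff u (gradPoly j) s * deriv l s = 0

/-- The successor of `q m` exists because the integral of `lenard (miuraCurv u) (q m)` is the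
variation of the `(m + 1)`-st Hamiltonian. -/
theorem IsRotation.exists_isLenardChain {q₀ : ℝ → ℂ} {l₀ : ℝ → ℝ} (hu : IsSmoothPer u)
    (h₀ : IsRotation u q₀ l₀) {m : ℕ}
    (h : ∀ j < m, ∫ s in 0..2 * π, evalDiff u (gradPoly j) s * deriv l₀ s = 0) :
    ∃ q l, IsLenardChain (miuraCurv u) m q ∧ q 0 = q₀ ∧ IsRotation u (q m) l := by
  induction m with
  | zero => exact ⟨fun _ => q₀, l₀, .zero h₀.circle, rfl, h₀⟩
  | succ m ih =>
    obtain ⟨q, l, hq, rfl, hl⟩ := ih fun j hj => h j (hj.trans m.lt_succ_self)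
    have hmean := hq.integral_shiftChain_mul_lenard hu h₀
    rw [(isRotation_shiftChain hu 0).integral_mul_lenard hu hl, h m m.lt_succ_self,
      evalDiff_gradPoly_zero, Complex.ofReal_inj] at hmean
    obtain ⟨w, hw, hwl⟩ := (hu.mul hl.real_circle.deriv).exists_primitive (by linarith)
    have hnext := hl.nextVelocity hu hw hwl
    refine ⟨_, fun s => 1 / 2 * (deriv (deriv l) s + u s * w s),
      hq.extend hnext.circle (hl.deriv_nextVelocity hu hw hwl),
      Function.update_of_ne (by omega) _ _, ?_⟩
    rwa [Function.update_self]

namespace IsLevelTangent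

variable {m : ℕ} {p q : ℝ → ℂ}

protected theorem hasLenardChain (hu : IsSmoothPer u) (hq : IsLevelTangent u m q) :
    HasLenardChain (miuraCurv u) m q := by
  obtain ⟨l, hl, h⟩ := hq
  obtain ⟨q, -, hq, hq0, -⟩ := hl.exists_isLenardChain hu h
  exact ⟨q, hq, hq0⟩

theorem ofReal_re_kdvForm (hu : IsSmoothPer u) (hp : IsLevelTangent u m p)
    (hq : IsLevelTangent u m q) :
    ((kdvForm (miuraCurv u) m p q).re : ℂ) = kdvForm (miuraCurv u) m p q := by
  have hchain := hp.hasLenardChain hu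
  obtain ⟨k, hk, -⟩ := hp
  obtain ⟨l₀, hl₀, h⟩ := hq
  obtain ⟨q, l, hq, rfl, hl⟩ := hl₀.exists_isLenardChain hu h
  rw [kdvForm_eq hu.miuraCurv hchain hq, hk.integral_mul_lenard hu hl, Complex.ofReal_re]

end IsLevelTangent

theorem kdvForm_one_left {m : ℕ} {q : ℝ → ℂ} {l : ℝ → ℝ} (hu : IsSmoothPer u)
    (hq : HasLenardChain (miuraCurv u) m q) (h : IsRotation u q l) :
    kdvForm (miuraCurv u) m (fun _ => 1) q =
      ((1 / 2 * ∫ s in 0..2 * π, evalDiff u (gradPoly m) s * deriv l s : ℝ) : ℂ) := by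
  obtain ⟨q, hq, rfl⟩ := hq
  exact (kdvForm_eq hu.miuraCurv ⟨_, isLenardChain_shiftChain hu m, rfl⟩ hq).trans
    (hq.integral_shiftChain_mul_lenard hu h)

end LevelTangent

/-! ### Smooth families of functions and the first variation -/

section SmoothFamilies

open MvPolynomial
open scoped Real

variable {E : Type*} [NormedAddCommGroup E] [NormedSpace ℝ E]

/-- Smooth one-parameter families of functions on the line. -/
def IsSmoothFamily (F : ℝ → ℝ → E) : Prop := ContDiff ℝ ∞ fun x : ℝ × ℝ => F x.1 x.2

/-- The derivative of a family in its parameter. -/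
def derivT (F : ℝ → ℝ → E) (t s : ℝ) : E := deriv (fun t => F t s) t

/-- The derivative of the members of a family. -/
def derivS (F : ℝ → ℝ → E) (t s : ℝ) : E := deriv (F t) s

namespace IsSmoothFamily

variable {F : ℝ → ℝ → E}

protected theorem hasFDerivAt (hF : IsSmoothFamily F) (x : ℝ × ℝ) :
    HasFDerivAt (fun x : ℝ × ℝ => F x.1 x.2) (fderiv ℝ (fun x : ℝ × ℝ => F x.1 x.2) x) x :=
  (hF.differentiable (by simp) x).hasFDerivAt

theorem derivT_eq (hF : IsSmoothFamily F) (t s : ℝ) :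
    derivT F t s = fderiv ℝ (fun x : ℝ × ℝ => F x.1 x.2) (t, s) (1, 0) :=
  (HasFDerivAt.comp_hasDerivAt (f := fun t => (t, s)) t (hF.hasFDerivAt (t, s))
    ((hasDerivAt_id' t).prodMk (hasDerivAt_const t s))).deriv

theorem derivS_eq (hF : IsSmoothFamily F) (t s : ℝ) :
    derivS F t s = fderiv ℝ (fun x : ℝ × ℝ => F x.1 x.2) (t, s) (0, 1) :=
  (HasFDerivAt.comp_hasDerivAt (f := fun s => (t, s)) s (hF.hasFDerivAt (t, s))
    ((hasDerivAt_const s t).prodMk (hasDerivAt_id' s))).deriv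

protected theorem contDiff (hF : IsSmoothFamily F) (t : ℝ) : ContDiff ℝ ∞ (F t) :=
  ContDiff.comp (g := fun x : ℝ × ℝ => F x.1 x.2) hF (contDiff_const.prodMk contDiff_id)

protected theorem hasDerivAt (hF : IsSmoothFamily F) (t s : ℝ) :
    HasDerivAt (fun t => F t s) (derivT F t s) t :=
  (ContDiff.differentiable (ContDiff.comp (g := fun x : ℝ × ℝ => F x.1 x.2) hF
    (contDiff_id.prodMk contDiff_const)) (by simp) t).hasDerivAt

protected theorem derivT (hF : IsSmoothFamily F) : IsSmoothFamily (derivT F) := by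
  simp only [IsSmoothFamily, hF.derivT_eq]
  exact (hF.fderiv_right (by simp)).clm_apply contDiff_const

protected theorem derivS (hF : IsSmoothFamily F) : IsSmoothFamily (derivS F) := by
  simp only [IsSmoothFamily, hF.derivS_eq]
  exact (hF.fderiv_right (by simp)).clm_apply contDiff_const

theorem derivT_derivS (hF : IsSmoothFamily F) : derivT (derivS F) = derivS (derivT F) := by
  funext t s
  have hd : DifferentiableAt ℝ (fderiv ℝ fun x : ℝ × ℝ => F x.1 x.2) (t, s) :=
    (hF.fderiv_right (m := 1) (by norm_cast)).differentiable (by simp) _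
  have hsymm : IsSymmSndFDerivAt ℝ (fun x : ℝ × ℝ => F x.1 x.2) (t, s) :=
    hF.contDiffAt.isSymmSndFDerivAt (by
      rw [minSmoothness_of_isRCLikeNormedField]
      exact WithTop.coe_le_coe.mpr (le_top (a := (2 : ℕ∞))))
  rw [hF.derivS.derivT_eq, hF.derivT.derivS_eq]
  simp only [hF.derivS_eq, hF.derivT_eq]
  rw [fderiv_clm_apply hd (differentiableAt_const _),
    fderiv_clm_apply hd (differentiableAt_const _)]
  simp only [fderiv_fun_const, Pi.zero_apply, ContinuousLinearMap.comp_zero, zero_add,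
    ContinuousLinearMap.flip_apply]
  exact hsymm.eq _ _

protected theorem iteratedDeriv (hF : IsSmoothFamily F) (j : ℕ) :
    IsSmoothFamily fun t => iteratedDeriv j (F t) := by
  induction j with
  | zero => simpa only [iteratedDeriv_zero] using hF
  | succ j ih =>
    simp only [iteratedDeriv_succ]
    exact ih.derivS

theorem derivT_iteratedDeriv (hF : IsSmoothFamily F) (j : ℕ) (t : ℝ) :
    derivT (fun t => iteratedDeriv j (F t)) t = iteratedDeriv j (derivT F t) := by
  induction j with
  | zero => simp only [iteratedDeriv_zero]
  | succ j ih =>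
    simp only [iteratedDeriv_succ, ← ih]
    exact congrFun (hF.iteratedDeriv j).derivT_derivS t

protected theorem mul {A : Type*} [NormedRing A] [NormedAlgebra ℝ A] {F G : ℝ → ℝ → A}
    (hF : IsSmoothFamily F) (hG : IsSmoothFamily G) :
    IsSmoothFamily fun t s => F t s * G t s := ContDiff.mul hF hG

theorem hasDerivAt_integral (hF : IsSmoothFamily F) (a b t : ℝ) :
    HasDerivAt (fun t => ∫ s in a..b, F t s) (∫ s in a..b, derivT F t s) t := by
  obtain ⟨C, hC⟩ := ((isCompact_Icc (a := t - 1) (b := t + 1)).prod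
    (isCompact_uIcc (a := a) (b := b))).exists_bound_of_continuousOn
      hF.derivT.continuous.continuousOn
  refine (intervalIntegral.hasDerivAt_integral_of_dominated_loc_of_deriv_le
    (F := F) (F' := derivT F) (bound := fun _ => C)
    (Icc_mem_nhds (sub_one_lt t) (lt_add_one t)) ?_ ?_ ?_ ?_ ?_ ?_).2
  · exact .of_forall fun t => (hF.contDiff t).continuous.aestronglyMeasurable
  · exact (hF.contDiff t).continuous.intervalIntegrable _ _
  · exact (hF.derivT.contDiff t).continuous.aestronglyMeasurable
  · exact .of_forall fun s hs t ht => hC (t, s) ⟨ht, Set.uIoc_subset_uIcc hs⟩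
  · exact intervalIntegrable_const
  · exact .of_forall fun s _ t _ => hF.hasDerivAt t s

protected theorem evalDiff {U : ℝ → ℝ → ℝ} (hU : IsSmoothFamily U) (p : DiffPoly) :
    IsSmoothFamily fun t => evalDiff (U t) p := by
  unfold ClosedCurves.evalDiff
  induction p using MvPolynomial.induction_on with
  | C a => simpa only [eval_C, IsSmoothFamily] using contDiff_const
  | add p q hp hq =>
    simp only [map_add]
    exact ContDiff.add hp hq
  | mul_X p i hp => simpa only [map_mul, eval_X] using hp.mul (hU.iteratedDeriv i)

theorem derivT_evalDiff {U : ℝ → ℝ → ℝ} (hU : IsSmoothFamily U) (p : DiffPoly) (t s : ℝ) :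
    derivT (fun t => evalDiff (U t) p) t s =
      ∑ j ∈ p.vars, evalDiff (U t) (pderiv j p) s * iteratedDeriv j (derivT U t) s := by
  simp only [← hU.derivT_iteratedDeriv]
  exact (hasDerivAt_eval (fun j => (hU.iteratedDeriv j).hasDerivAt t s) p).deriv

end IsSmoothFamily

theorem integral_evalDiff_mul_iteratedDeriv {u v : ℝ → ℝ} (hu : IsSmoothPer u)
    (hv : IsSmoothPer v) (j : ℕ) (q : DiffPoly) :
    ∫ s in 0..2 * π, evalDiff u q s * iteratedDeriv j v s =
      ∫ s in 0..2 * π, evalDiff u ((-1) ^ j * totalD^[j] q) s * v s := by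
  induction j generalizing q with
  | zero => simp
  | succ j ih =>
    rw [iteratedDeriv_succ, (hu.evalDiff q).integral_mul_deriv (hv.iteratedDeriv j),
      deriv_evalDiff hu, ih, ← intervalIntegral.integral_neg]
    simp only [Function.iterate_succ_apply, pow_succ, mul_neg, mul_one, evalDiff, map_neg, neg_mul]

theorem IsSmoothFamily.integral_derivT_evalDiff {U : ℝ → ℝ → ℝ} {t : ℝ} (hU : IsSmoothFamily U)
    (hu : IsSmoothPer (U t)) (hv : IsSmoothPer (derivT U t)) (p : DiffPoly) :
    ∫ s in 0..2 * π, derivT (fun t => evalDiff (U t) p) t s =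
      ∫ s in 0..2 * π, evalDiff (U t) (varDeriv p) s * derivT U t s := by
  have hvar (s : ℝ) : evalDiff (U t) (varDeriv p) s * derivT U t s =
      ∑ j ∈ p.vars, evalDiff (U t) ((-1) ^ j * totalD^[j] (pderiv j p)) s * derivT U t s := by
    rw [varDeriv, evalDiff, map_sum, Finset.sum_mul]
    rfl
  simp only [hU.derivT_evalDiff, hvar]
  rw [intervalIntegral.integral_finsetSum, intervalIntegral.integral_finsetSum]
  · exact Finset.sum_congr rfl fun j _ => integral_evalDiff_mul_iteratedDeriv hu hv j _
  · exact fun j _ => ((hu.evalDiff _).mul hv).intervalIntegrable _ _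
  · exact fun j _ => ((hu.evalDiff _).mul (hv.iteratedDeriv j)).intervalIntegrable _ _

end SmoothFamilies

/-! ### Motions of closed curves -/

section Motions

open Complex
open scoped Real

/-- The components of `V` in the moving frame: `V = (frameComp γ V) γ_s`. -/
def frameComp (γ V : ℝ → ℂ) (s : ℝ) : ℂ := star (deriv γ s) * V s

/-- The angular velocity of the unit tangent vector under a deformation with velocity `V`. -/
def angVel (γ V : ℝ → ℂ) (s : ℝ) : ℝ := (star (deriv γ s) * deriv V s).im

theorem star_mul_self_of_norm_eq_one {z : ℂ} (h : ‖z‖ = 1) : star z * z = 1 := by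
  rw [star_def, conj_mul', h, ofReal_one, one_pow]

theorem deriv_eq_of_norm_eq_one {f : ℝ → ℂ} {f' : ℂ} {t : ℝ} (h : ∀ t, ‖f t‖ = 1)
    (hf : HasDerivAt f f' t) : f' = I * (star (f t) * f').im * f t := by
  have hconst : HasDerivAt (fun t => star (f t) * f t) 0 t := by
    simp only [star_mul_self_of_norm_eq_one (h _)]
    exact hasDerivAt_const t 1
  have hre : (star (f t) * f').re = 0 := by
    have := congrArg re ((hf.star.mul hf).unique hconst)
    simp only [add_re, mul_re, star_def, conj_re, conj_im, zero_re] at this ⊢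
    linarith
  have him : star (f t) * f' = I * (star (f t) * f').im :=
    Complex.ext (by rw [hre, I_mul_re, ofReal_im, neg_zero]) (by rw [I_mul_im, ofReal_re])
  rw [← him, mul_right_comm, star_mul_self_of_norm_eq_one (h t), one_mul]

theorem IsSmoothPer.star_mul {f g : ℝ → ℂ} (hf : IsSmoothPer f) (hg : IsSmoothPer g) :
    IsSmoothPer fun s => star (f s) * g s :=
  ⟨(conjCLE.contDiff.comp hf.1).mul hg.1, (hf.2.comp star).mul hg.2⟩

theorem IsSmoothPer.im {f : ℝ → ℂ} (hf : IsSmoothPer f) : IsSmoothPer fun s => (f s).im :=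
  ⟨imCLM.contDiff.comp hf.1, hf.2.comp Complex.im⟩

theorem IsSmoothFamily.im_star_mul {F G : ℝ → ℝ → ℂ} (hF : IsSmoothFamily F)
    (hG : IsSmoothFamily G) : IsSmoothFamily fun t s => (star (F t s) * G t s).im :=
  imCLM.contDiff.comp ((conjCLE.contDiff.comp hF).mul hG)

theorem hasDerivAt_im_star_mul {f g : ℝ → ℂ} {f' g' : ℂ} {t : ℝ} (hf : HasDerivAt f f' t)
    (hg : HasDerivAt g g' t) :
    HasDerivAt (fun t => (star (f t) * g t).im) ((star f' * g t + star (f t) * g').im) t :=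
  imCLM.hasFDerivAt.comp_hasDerivAt t (hf.star.mul hg)

/-- If `T_t = i ν T` and `T_s = i κ T`, then `κ_t = ν_s`: the derivatives of `κ` and `ν` differ by
`2 Im (T̄_t T_s) = 2 Im (κ ν) = 0`. -/
theorem IsSmoothFamily.derivT_im_star_mul_derivS {T : ℝ → ℝ → ℂ} (hT : IsSmoothFamily T)
    (h : ∀ t s, ‖T t s‖ = 1) :
    derivT (fun t s => (star (T t s) * derivS T t s).im) =
      derivS fun t s => (star (T t s) * derivT T t s).im := by
  funext t s
  have hTs : HasDerivAt (T t) (derivS T t s) s :=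
    ((hT.contDiff t).differentiable (by simp) s).hasDerivAt
  have hTts : HasDerivAt (derivT T t) (derivS (derivT T) t s) s :=
    ((hT.derivT.contDiff t).differentiable (by simp) s).hasDerivAt
  have hreal : (star (derivT T t s) * derivS T t s).im = 0 := by
    rw [deriv_eq_of_norm_eq_one (fun t => h t s) (hT.hasDerivAt t s),
      deriv_eq_of_norm_eq_one (h t) hTs]
    simp only [star_def, map_mul, conj_I, conj_ofReal, mul_im, mul_re, conj_re, conj_im, neg_re,
      neg_im, I_re, I_im, ofReal_re, ofReal_im]
    ring
  refine ((hasDerivAt_im_star_mul (hT.hasDerivAt t s) (hT.derivS.hasDerivAt t s)).deriv.trans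
    ?_).trans (hasDerivAt_im_star_mul hTs hTts).deriv.symm
  rw [hT.derivT_derivS]
  simp only [star_def, add_im, mul_im, conj_re, conj_im] at hreal ⊢
  linarith

section MHat

variable {γ : ℝ → ℂ}

theorem isSmoothPer_of_mem_MHat (h : γ ∈ MHat) : IsSmoothPer γ := ⟨h.1, h.2.1⟩

theorem isSmoothPer_curvHat (h : γ ∈ MHat) : IsSmoothPer (curvHat γ) :=
  have hγ := isSmoothPer_of_mem_MHat h
  (hγ.deriv.star_mul hγ.deriv.deriv).im

theorem hasDerivAt_deriv_of_mem_MHat (h : γ ∈ MHat) (s : ℝ) :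
    HasDerivAt (deriv γ) (I * curvHat γ s * deriv γ s) s :=
  have hd := (isSmoothPer_of_mem_MHat h).deriv.hasDerivAt s
  deriv_eq_of_norm_eq_one h.2.2 hd ▸ hd

theorem frameComp_mul_deriv (h : γ ∈ MHat) (V : ℝ → ℂ) (s : ℝ) :
    frameComp γ V s * deriv γ s = V s := by
  rw [frameComp, mul_right_comm, star_mul_self_of_norm_eq_one (h.2.2 s), one_mul]

end MHat

namespace IsMotion

variable {Γ : ℝ → ℝ → ℂ} {γ V : ℝ → ℂ}

theorem isSmoothFamily (h : IsMotion Γ γ V) : IsSmoothFamily Γ := h.1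

theorem apply_zero (h : IsMotion Γ γ V) : Γ 0 = γ := h.2.2.1

theorem mem_MHat (h : IsMotion Γ γ V) : γ ∈ MHat := h.apply_zero ▸ h.2.1 0

theorem derivT_zero (h : IsMotion Γ γ V) : derivT Γ 0 = V := funext h.2.2.2

theorem isSmoothPer_derivT (h : IsMotion Γ γ V) (t : ℝ) : IsSmoothPer (derivT Γ t) :=
  ⟨h.isSmoothFamily.derivT.contDiff t, fun s => by simp only [derivT, (h.2.1 _).2.1 s]⟩

theorem isSmoothPer (h : IsMotion Γ γ V) : IsSmoothPer V :=
  h.derivT_zero ▸ h.isSmoothPer_derivT 0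

theorem deriv_velocity (h : IsMotion Γ γ V) (s : ℝ) :
    deriv V s = I * angVel γ V s * deriv γ s := by
  have hrot := deriv_eq_of_norm_eq_one (f := fun t => derivS Γ t s) (fun t => (h.2.1 t).2.2 s)
    (h.isSmoothFamily.derivS.hasDerivAt 0 s)
  rwa [h.isSmoothFamily.derivT_derivS, derivS, derivS, h.derivT_zero, h.apply_zero] at hrot

theorem isRotation (h : IsMotion Γ γ V) :
    IsRotation (curvHat γ) (frameComp γ V) (angVel γ V) := by
  have hγ := isSmoothPer_of_mem_MHat h.mem_MHat
  refine ⟨hγ.deriv.star_mul h.isSmoothPer, (hγ.deriv.star_mul h.isSmoothPer.deriv).im, fun s => ?_⟩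
  refine ((hasDerivAt_deriv_of_mem_MHat h.mem_MHat s).star.mul
    (h.isSmoothPer.hasDerivAt s)).deriv.trans ?_
  have hunit := star_mul_self_of_norm_eq_one (h.mem_MHat.2.2 s)
  rw [h.deriv_velocity, frameComp]
  simp only [star_mul', star_def, conj_I, conj_ofReal] at hunit ⊢
  linear_combination I * angVel γ V s * hunit

theorem derivT_curvHat (h : IsMotion Γ γ V) (t : ℝ) :
    derivT (fun t => curvHat (Γ t)) t = deriv (angVel (Γ t) (derivT Γ t)) := by
  have hcurv := congrFun (h.isSmoothFamily.derivS.derivT_im_star_mul_derivS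
    fun t => (h.2.1 t).2.2) t
  rwa [h.isSmoothFamily.derivT_derivS] at hcurv

theorem hasDerivAt_functionalHat (h : IsMotion Γ γ V) (p : DiffPoly) :
    HasDerivAt (fun t => functionalHat p (Γ t))
      (∫ s in 0..2 * π, evalDiff (curvHat γ) (varDeriv p) s * deriv (angVel γ V) s) 0 := by
  have hU : IsSmoothFamily fun t => curvHat (Γ t) :=
    h.isSmoothFamily.derivS.im_star_mul h.isSmoothFamily.derivS.derivS
  have hv : derivT (fun t => curvHat (Γ t)) 0 = deriv (angVel γ V) := by
    rw [h.derivT_curvHat, h.derivT_zero, h.apply_zero]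
  have hd := (hU.evalDiff p).hasDerivAt_integral 0 (2 * π) 0
  rwa [hU.integral_derivT_evalDiff (isSmoothPer_curvHat (h.2.1 0))
    (hv ▸ h.isRotation.real_circle.deriv), hv, h.apply_zero] at hd

end IsMotion

end Motions

/-! ### Smooth square roots -/

section SquareRoots

open Complex
open scoped Real

variable {E : Type*} [NormedAddCommGroup E] [NormedSpace ℝ E]

theorem contDiff_of_contDiff_exp_mul_I {n : WithTop ℕ∞} {θ : E → ℝ} (hθ : Continuous θ)
    (h : ContDiff ℝ n fun x => exp (θ x * I)) : ContDiff ℝ n θ := by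
  refine contDiff_iff_contDiffAt.mpr fun x₀ => ?_
  have hexp (x : E) : exp (θ x * I) / exp (θ x₀ * I) = exp ((θ x - θ x₀ : ℝ) * I) := by
    rw [← exp_sub, ofReal_sub, sub_mul]
  have hlog : ContDiffAt ℝ n (fun x => log (exp (θ x * I) / exp (θ x₀ * I))) x₀ := by
    refine ContDiffAt.comp (g := log) x₀ (ContDiffAt.restrict_scalars ℝ (contDiffAt_log ?_))
      (h.contDiffAt.div_const _)
    rw [div_self (exp_ne_zero _)]
    exact one_mem_slitPlane
  have hnear : ∀ᶠ x in nhds x₀, |θ x - θ x₀| < π := by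
    have hlim := (hθ.sub continuous_const).abs.tendsto (x := x₀) (f := fun x => |θ x - θ x₀|)
    rw [sub_self, abs_zero] at hlim
    exact hlim.eventually (gt_mem_nhds Real.pi_pos)
  refine (contDiffAt_const.add (imCLM.contDiff.contDiffAt.comp x₀ hlog)).congr_of_eventuallyEq
    (f := fun x => θ x₀ + (log (exp (θ x * I) / exp (θ x₀ * I))).im) ?_
  filter_upwards [hnear] with x hx
  rw [hexp, log_exp, im_ofReal_mul, I_im, mul_one, add_sub_cancel]
  · simpa using (abs_lt.mp hx).1
  · simpa using (abs_lt.mp hx).2.le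

theorem exists_contDiff_arg {n : WithTop ℕ∞} {F : E → ℂ} (hF : ContDiff ℝ n F)
    (h : ∀ x, ‖F x‖ = 1) : ∃ θ : E → ℝ, ContDiff ℝ n θ ∧ ∀ x, exp (θ x * I) = F x := by
  let f : C(E, Circle) :=
    ⟨fun x => ⟨F x, mem_sphere_zero_iff_norm.mpr (h x)⟩, hF.continuous.subtype_mk _⟩
  obtain ⟨θ, ⟨-, hθ⟩, -⟩ :=
    Circle.isCoveringMap_exp.existsUnique_continuousMap_lifts f 0 _ (Circle.exp_arg (f 0))
  have hexp (x : E) : exp (θ x * I) = F x :=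
    (Circle.coe_exp _).symm.trans (congrArg Subtype.val (congrFun hθ x))
  exact ⟨θ, contDiff_of_contDiff_exp_mul_I θ.continuous (by simpa only [hexp] using hF), hexp⟩

theorem exists_contDiff_sqrt {n : WithTop ℕ∞} {F : E → ℂ} (hF : ContDiff ℝ n F)
    (h : ∀ x, ‖F x‖ = 1) : ∃ G : E → ℂ, ContDiff ℝ n G ∧ ∀ x, G x ^ 2 * F x = 1 := by
  obtain ⟨θ, hθ, hexp⟩ := exists_contDiff_arg hF h
  refine ⟨fun x => exp (((-(1 / 2) * θ x : ℝ) : ℂ) * I),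
    ((ofRealCLM.contDiff.comp (contDiff_const.mul hθ)).mul contDiff_const).cexp, fun x => ?_⟩
  rw [← hexp x, ← exp_nat_mul, ← exp_add, ← exp_zero]
  congr 1
  push_cast
  ring

theorem eq_or_eq_neg_of_sq_mul_eq_one {X : Type*} [TopologicalSpace X] [PreconnectedSpace X]
    {f g F : X → ℂ} (hf : Continuous f) (hg : Continuous g) (hfF : ∀ x, f x ^ 2 * F x = 1)
    (hgF : ∀ x, g x ^ 2 * F x = 1) : f = g ∨ f = -g := by
  have hF (x : X) : F x ≠ 0 := right_ne_zero_of_mul (hfF x ▸ one_ne_zero)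
  have hg0 (x : X) : g x ≠ 0 := pow_ne_zero_iff two_ne_zero |>.mp <|
    left_ne_zero_of_mul (hgF x ▸ one_ne_zero)
  refine (isPreconnected_univ.eq_or_eq_neg_of_sq_eq hf.continuousOn hg.continuousOn
    (fun x _ => mul_right_cancel₀ (hF x) ((hfF x).trans (hgF x).symm)) fun {x} _ => hg0 x).imp ?_ ?_
  · exact fun h => funext fun x => h (Set.mem_univ x)
  · exact fun h => funext fun x => h (Set.mem_univ x)

theorem IsSmoothFamily.exists_sqrt {F : ℝ → ℝ → ℂ} {ρ : ℝ → ℂ} (hF : IsSmoothFamily F)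
    (h : ∀ t s, ‖F t s‖ = 1) (hρ : Continuous ρ) (hρF : ∀ s, ρ s ^ 2 * F 0 s = 1) :
    ∃ R : ℝ → ℝ → ℂ, IsSmoothFamily R ∧ (∀ t s, R t s ^ 2 * F t s = 1) ∧ R 0 = ρ := by
  obtain ⟨G, hG, hGF⟩ := exists_contDiff_sqrt hF fun x => h x.1 x.2
  rcases eq_or_eq_neg_of_sq_mul_eq_one (f := fun s => G (0, s))
    (hG.continuous.comp (by fun_prop)) hρ (fun s => hGF (0, s)) hρF with h₀ | h₀
  · exact ⟨fun t s => G (t, s), hG, fun t s => hGF (t, s), h₀⟩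
  · refine ⟨fun t s => -G (t, s), hG.neg, fun t s => ?_, neg_eq_iff_eq_neg.mpr h₀⟩
    rw [neg_sq, hGF (t, s)]

end SquareRoots

/-! ### The geometric Miura transformation -/

section GeometricMiura

open Complex
open scoped Real

theorem hasDerivAt_of_sq_snd_mul_neg_eq_one {D : ℝ → ℂ × ℂ} {f T : ℝ → ℂ} {f' c : ℂ} {x : ℝ}
    (hD : DifferentiableAt ℝ D x) (hfst : ∀ x, (D x).1 = (D x).2 * f x)
    (hsnd : ∀ x, (D x).2 ^ 2 * (-T x) = 1) (hf : HasDerivAt f f' x)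
    (hT : HasDerivAt T (c * T x) x) :
    HasDerivAt D ((-(1 / 2) * c) • D x + ((D x).2 * f', 0)) x := by
  have hr : HasDerivAt (fun x => (D x).2) (deriv (fun x => (D x).2) x) x := hD.snd.hasDerivAt
  have hr' : deriv (fun x => (D x).2) x = -(1 / 2) * c * (D x).2 := by
    have hone : HasDerivAt (fun x => (D x).2 ^ 2 * (-T x)) 0 x := by
      simp only [hsnd]
      exact hasDerivAt_const x 1
    have hlog := ((hr.pow 2).mul hT.neg).unique hone
    have hne : 2 * ((D x).2 * T x) ≠ 0 := by
      refine mul_ne_zero two_ne_zero fun h0 => one_ne_zero (α := ℂ) ?_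
      linear_combination -(hsnd x) - (D x).2 * h0
    refine mul_left_cancel₀ hne ?_
    simp only [Pi.pow_apply, Pi.neg_apply] at hlog
    push_cast at hlog
    linear_combination -hlog
  rw [hr'] at hr
  rw [show D = fun x => ((D x).2 * f x, (D x).2) from funext fun x => Prod.ext (hfst x) rfl]
  refine ((hr.mul hf).prodMk hr).congr_deriv (Prod.ext ?_ ?_) <;>
    simp only [Prod.smul_mk, Prod.mk_add_mk, smul_eq_mul] <;> ring

theorem exists_isMiura {γ : ℝ → ℂ} (hγ : γ ∈ MHat) : ∃ δ, IsMiura γ δ := by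
  obtain ⟨ρ, hρ, hργ⟩ := exists_contDiff_sqrt (F := fun s => -deriv γ s)
    (isSmoothPer_of_mem_MHat hγ).deriv.1.neg fun s => by rw [norm_neg, hγ.2.2 s]
  exact ⟨fun s => (ρ s * γ s, ρ s), ρ, hρ, hργ, fun _ => rfl⟩

namespace IsMiura

variable {γ : ℝ → ℂ} {δ : ℝ → ℂ × ℂ}

theorem contDiff_snd (h : IsMiura γ δ) : ContDiff ℝ ∞ fun s => (δ s).2 := by
  obtain ⟨ρ, hρ, -, hδ⟩ := h
  simpa only [hδ] using hρ

theorem sq_snd_mul_neg_deriv (h : IsMiura γ δ) (s : ℝ) : (δ s).2 ^ 2 * (-deriv γ s) = 1 := by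
  obtain ⟨ρ, -, hργ, hδ⟩ := h
  rw [hδ, hργ]

theorem fst_eq (h : IsMiura γ δ) (s : ℝ) : (δ s).1 = (δ s).2 * γ s := by
  obtain ⟨ρ, -, -, hδ⟩ := h
  rw [hδ]

theorem eq_mk (h : IsMiura γ δ) (s : ℝ) : δ s = ((δ s).2 * γ s, (δ s).2) :=
  Prod.ext (h.fst_eq s) rfl

protected theorem contDiff (hγ : γ ∈ MHat) (h : IsMiura γ δ) : ContDiff ℝ ∞ δ := by
  rw [show δ = fun s => ((δ s).2 * γ s, (δ s).2) from funext h.eq_mk]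
  exact (h.contDiff_snd.mul hγ.1).prodMk h.contDiff_snd

protected theorem hasDerivAt (hγ : γ ∈ MHat) (h : IsMiura γ δ) (s : ℝ) :
    HasDerivAt δ ((-(1 / 2) * (I * curvHat γ s)) • δ s + ((δ s).2 * deriv γ s, 0)) s :=
  hasDerivAt_of_sq_snd_mul_neg_eq_one ((h.contDiff hγ).differentiable (by simp) s) h.fst_eq
    h.sq_snd_mul_neg_deriv ((isSmoothPer_of_mem_MHat hγ).hasDerivAt s)
    (hasDerivAt_deriv_of_mem_MHat hγ s)

theorem deriv_deriv (hγ : γ ∈ MHat) (h : IsMiura γ δ) (s : ℝ) :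
    deriv (deriv δ) s = -miuraCurv (curvHat γ) s • δ s := by
  have hδ := h.hasDerivAt hγ s
  have hδ₂ : HasDerivAt (fun s => (δ s).2) (-(1 / 2) * (I * curvHat γ s) * (δ s).2) s :=
    ((ContinuousLinearMap.snd ℝ ℂ ℂ).hasFDerivAt.comp_hasDerivAt s hδ).congr_deriv (by simp)
  have hc := (((isSmoothPer_curvHat hγ).hasDerivAt_ofReal s).const_mul I).const_mul (-(1 / 2) : ℂ)
  rw [show deriv δ = _ from funext fun s => (h.hasDerivAt hγ s).deriv]
  refine ((hc.smul hδ).add ((hδ₂.mul (hasDerivAt_deriv_of_mem_MHat hγ s)).prodMk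
    (hasDerivAt_const s 0))).deriv.trans ?_
  rw [h.eq_mk s, miuraCurv]
  simp only [Prod.smul_mk, Prod.mk_add_mk, smul_eq_mul, add_zero]
  refine Prod.ext ?_ ?_
  · linear_combination (1 / 4 * (curvHat γ s : ℂ) ^ 2 * (δ s).2 * γ s) * I_sq
  · linear_combination (1 / 4 * (curvHat γ s : ℂ) ^ 2 * (δ s).2) * I_sq

theorem det2_deriv (hγ : γ ∈ MHat) (h : IsMiura γ δ) (s : ℝ) : det2 (δ s) (deriv δ s) = 1 := by
  rw [(h.hasDerivAt hγ s).deriv, h.eq_mk s]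
  simp only [det2, Prod.smul_mk, Prod.mk_add_mk, smul_eq_mul, add_zero]
  linear_combination h.sq_snd_mul_neg_deriv s

theorem mem_MC (hγ : γ ∈ MHat) (h : IsMiura γ δ) : δ ∈ MC := by
  have hper := isSmoothPer_of_mem_MHat hγ
  refine ⟨h.contDiff hγ, ?_, h.det2_deriv hγ⟩
  rcases eq_or_eq_neg_of_sq_mul_eq_one (f := fun s => (δ (s + 2 * π)).2)
    (h.contDiff_snd.continuous.comp (by fun_prop)) h.contDiff_snd.continuous
    (fun s => by rw [← h.sq_snd_mul_neg_deriv (s + 2 * π), hper.deriv.2])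
    h.sq_snd_mul_neg_deriv with hsign | hsign
  · exact .inl fun s => by rw [h.eq_mk, h.eq_mk s, hper.2, congrFun hsign s]
  · refine .inr fun s => ?_
    rw [h.eq_mk, h.eq_mk s, hper.2, congrFun hsign s, Pi.neg_apply, neg_mul, Prod.neg_mk]

protected theorem curvC (hγ : γ ∈ MHat) (h : IsMiura γ δ) :
    curvC δ = miuraCurv (curvHat γ) := by
  funext s
  have hdet := h.det2_deriv hγ s
  rw [ClosedCurves.curvC, h.deriv_deriv hγ]
  simp only [det2, Prod.smul_fst, Prod.smul_snd, smul_eq_mul] at hdet ⊢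
  linear_combination miuraCurv (curvHat γ) s * hdet

end IsMiura

theorem IsMiuraPush.represents {γ V : ℝ → ℂ} {δ W : ℝ → ℂ × ℂ} (h : IsMiuraPush γ δ V W) :
    Represents δ (frameComp γ V) W := by
  obtain ⟨Γ, Δ, hΓ, hΔ, hm, rfl, hW⟩ := h
  have hγ := hΓ.mem_MHat
  have hδ : IsMiura γ (Δ 0) := hΓ.apply_zero ▸ hm 0
  refine ⟨hΓ.isRotation.circle, fun s => ?_⟩
  have hT : HasDerivAt (fun t => derivS Γ t s) (I * angVel γ V s * derivS Γ 0 s) 0 := by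
    have hT := hΓ.isSmoothFamily.derivS.hasDerivAt 0 s
    rw [hΓ.isSmoothFamily.derivT_derivS, derivS, hΓ.derivT_zero, hΓ.deriv_velocity] at hT
    rwa [show derivS Γ 0 s = deriv γ s by rw [derivS, hΓ.apply_zero]]
  have hvelocity := (hasDerivAt_of_sq_snd_mul_neg_eq_one (D := fun t => Δ t s)
    (IsSmoothFamily.hasDerivAt hΔ 0 s).differentiableAt (fun t => (hm t).fst_eq s)
    (fun t => (hm t).sq_snd_mul_neg_deriv s) (hΓ.isSmoothFamily.hasDerivAt 0 s) hT).deriv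
  rw [hW, hvelocity, hΓ.derivT_zero, ← frameComp_mul_deriv hγ V s, hΓ.isRotation.deriv_eq,
    (hδ.hasDerivAt hγ s).deriv]
  refine Prod.ext ?_ ?_ <;>
    simp only [Prod.fst_add, Prod.snd_add, Prod.smul_fst, Prod.smul_snd, smul_eq_mul] <;> ring

theorem IsMotion.exists_isMiuraPush {Γ : ℝ → ℝ → ℂ} {γ V : ℝ → ℂ} {δ : ℝ → ℂ × ℂ}
    (hΓ : IsMotion Γ γ V) (hδ : IsMiura γ δ) : ∃ W, IsMiuraPush γ δ V W := by
  obtain ⟨R, hR, hRΓ, hR0⟩ := IsSmoothFamily.exists_sqrt (F := fun t s => -derivS Γ t s)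
    (ρ := fun s => (δ s).2) (ContDiff.neg hΓ.isSmoothFamily.derivS)
    (fun t s => by rw [norm_neg, derivS, (hΓ.2.1 t).2.2 s]) hδ.contDiff_snd.continuous
    (fun s => by rw [derivS, hΓ.apply_zero, hδ.sq_snd_mul_neg_deriv])
  refine ⟨_, Γ, fun t s => (R t s * Γ t s, R t s), hΓ, (ContDiff.mul hR hΓ.1).prodMk hR,
    fun t => ⟨R t, hR.contDiff t, hRΓ t, fun s => rfl⟩, ?_, fun s => rfl⟩
  simp only [hR0, hΓ.apply_zero, ← hδ.eq_mk]

end GeometricMiura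

/-! ### The forms `ω_k` in terms of Lenard chains -/

section OmegaForms

open scoped Real

variable {δ X Y : ℝ → ℂ × ℂ} {α β : ℝ → ℂ}

theorem isSmoothPer_curvC (hδ : δ ∈ MC) : IsSmoothPer (curvC δ) := by
  have hd : ContDiff ℝ ∞ (deriv δ) := (contDiff_infty_iff_deriv.mp hδ.1).2
  have hdd : ContDiff ℝ ∞ (deriv (deriv δ)) := (contDiff_infty_iff_deriv.mp hd).2
  refine ⟨(hd.fst.mul hdd.snd).sub (hd.snd.mul hdd.fst), fun s => ?_⟩
  have hshift : curvC δ (s + 2 * π) = curvC (fun s => δ (s + 2 * π)) s := by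
    have hd₁ : deriv (fun s => δ (s + 2 * π)) = fun s => deriv δ (s + 2 * π) :=
      funext fun s => deriv_comp_add_const δ _ s
    rw [curvC, curvC, hd₁, deriv_comp_add_const]
  rcases hδ.2.1 with hper | hper
  · rw [hshift, funext hper]
  · rw [hshift, funext hper]
    simp only [curvC, deriv.fun_neg', det2, Prod.fst_neg, Prod.snd_neg, neg_mul_neg]

theorem Represents.eq_det2 (h : Represents δ α X) (hδ : ∀ s, det2 (δ s) (deriv δ s) = 1) :
    α = fun s => det2 (δ s) (X s) := by
  funext s
  have hdet := hδ s
  rw [h.2 s]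
  simp only [det2, Prod.fst_add, Prod.snd_add, Prod.smul_fst, Prod.smul_snd, smul_eq_mul] at hdet ⊢
  linear_combination -α s * hdet

theorem hasOmega_iff {m : ℕ} {w : ℂ} (hδ : δ ∈ MC) (hX : Represents δ α X)
    (hY : Represents δ β Y) (hα : HasLenardChain (curvC δ) m α)
    (hβ : HasLenardChain (curvC δ) m β) :
    HasOmega (m + 1) δ X Y w ↔ w = kdvForm (curvC δ) m α β := by
  constructor
  · rintro ⟨-, α', β', a, b, hX', hY', hab, rfl⟩
    obtain rfl : α' = α := (hX'.eq_det2 hδ.2.2).trans (hX.eq_det2 hδ.2.2).symm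
    obtain rfl : β' = β := (hY'.eq_det2 hδ.2.2).trans (hY.eq_det2 hδ.2.2).symm
    rw [hab.eq_lenard m.lt_succ_self, ← hab.a_zero,
      kdvForm_eq (isSmoothPer_curvC hδ) hα hab.isLenardChain]
  · rintro rfl
    obtain ⟨q, hq, rfl⟩ := hβ
    refine ⟨hδ, α, q 0, q, _, hX, hY, hq.isOmegaIterates, ?_⟩
    rw [kdvForm_eq (isSmoothPer_curvC hδ) hα hq, Function.update_self]

end OmegaForms

/-! ### The action by parameter shift -/

section ParameterShift

theorem deriv_shift (σ : ℝ) (γ : ℝ → ℂ) : deriv (shift σ γ) = shift σ (deriv γ) :=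
  funext fun s => deriv_comp_add_const γ σ s

theorem curvHat_shift (σ : ℝ) (γ : ℝ → ℂ) :
    curvHat (shift σ γ) = fun s => curvHat γ (s + σ) := by
  funext s
  simp only [curvHat, deriv_shift]
  rfl

theorem frameComp_shift (σ : ℝ) (γ V : ℝ → ℂ) :
    frameComp (shift σ γ) (shift σ V) = fun s => frameComp γ V (s + σ) := by
  funext s
  simp only [frameComp, deriv_shift]
  rfl

theorem shift_mem_MHat {γ : ℝ → ℂ} (h : γ ∈ MHat) (σ : ℝ) : shift σ γ ∈ MHat := by
  have hper := (isSmoothPer_of_mem_MHat h).comp_add σ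
  refine ⟨hper.1, hper.2, fun s => ?_⟩
  rw [deriv_shift]
  exact h.2.2 _

theorem functionalHat_shift {γ : ℝ → ℂ} (h : γ ∈ MHat) (p : DiffPoly) (σ : ℝ) :
    functionalHat p (shift σ γ) = functionalHat p γ := by
  simp only [functionalHat, curvHat_shift, iteratedDeriv_comp_add_const]
  exact ((isSmoothPer_curvHat h).evalDiff p).integral_comp_add σ

theorem shift_mem_levelHat {h : ℕ → DiffPoly} {c : ℕ → ℝ} {m : ℕ} {γ : ℝ → ℂ}
    (hγ : γ ∈ levelHat h c m) (σ : ℝ) : shift σ γ ∈ levelHat h c m :=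
  ⟨shift_mem_MHat hγ.1 σ, fun k hk hkm => by rw [functionalHat_shift hγ.1, hγ.2 k hk hkm]⟩

theorem IsMotion.shift {Γ : ℝ → ℝ → ℂ} {γ V : ℝ → ℂ} (h : IsMotion Γ γ V) (σ : ℝ) :
    IsMotion (fun t => shift σ (Γ t)) (shift σ γ) (shift σ V) :=
  ⟨ContDiff.comp (g := fun x : ℝ × ℝ => Γ x.1 x.2) h.1
      (contDiff_fst.prodMk (contDiff_snd.add contDiff_const)),
    fun t => shift_mem_MHat (h.2.1 t) σ, congrArg (ClosedCurves.shift σ) h.apply_zero,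
    fun s => h.2.2.2 (s + σ)⟩

theorem IsTangentHat.shift {h : ℕ → DiffPoly} {m : ℕ} {γ V : ℝ → ℂ} (hV : IsTangentHat h m γ V)
    (σ : ℝ) : IsTangentHat h m (shift σ γ) (shift σ V) := by
  obtain ⟨Γ, hΓ, hd⟩ := hV
  refine ⟨_, hΓ.shift σ, fun k hk hkm => ?_⟩
  simpa only [functionalHat_shift (hΓ.2.1 _)] using hd k hk hkm

theorem fundamentalField_eq_deriv (γ : ℝ → ℂ) : fundamentalField γ = deriv γ :=
  funext fun s => (deriv_comp_const_add γ s 0).trans (by rw [add_zero])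

theorem frameComp_fundamentalField {γ : ℝ → ℂ} (h : γ ∈ MHat) :
    frameComp γ (fundamentalField γ) = fun _ => 1 := by
  funext s
  rw [fundamentalField_eq_deriv]
  exact star_mul_self_of_norm_eq_one (h.2.2 s)

theorem isMotion_fundamentalField {γ : ℝ → ℂ} (h : γ ∈ MHat) :
    IsMotion (fun t => shift t γ) γ (fundamentalField γ) :=
  ⟨h.1.comp (contDiff_snd.add contDiff_fst), shift_mem_MHat h,
    funext fun s => congrArg γ (add_zero s), fun _ => rfl⟩

theorem isTangentHat_fundamentalField {γ : ℝ → ℂ} (h : γ ∈ MHat) (p : ℕ → DiffPoly) (m : ℕ) :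
    IsTangentHat p m γ (fundamentalField γ) := by
  refine ⟨_, isMotion_fundamentalField h, fun k _ _ => ?_⟩
  simp only [functionalHat_shift h]
  exact hasDerivAt_const 0 _

end ParameterShift

/-! ### The form on the level sets -/

section OmegaHat

open scoped Real

/-- The pullback `ω̂_{m + 1}` of `ω_{m + 1}` along the geometric Miura transformation. On tangent
vectors of the level sets of the first `m` Hamiltonians `kdvForm` is real, so that no information
is lost in taking the real part. -/
def omegaHat (m : ℕ) (γ V V' : ℝ → ℂ) : ℝ :=
  (kdvForm (miuraCurv (curvHat γ)) m (frameComp γ V) (frameComp γ V')).re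

theorem IsMKdVDensity.integral_gradPoly_mul {k : ℕ} {p : DiffPoly} (hp : IsMKdVDensity (k + 1) p)
    (u v : ℝ → ℝ) :
    1 / 2 * ∫ s in 0..2 * π, evalDiff u (gradPoly k) s * v s =
      ∫ s in 0..2 * π, evalDiff u (varDeriv p) s * v s := by
  rw [← intervalIntegral.integral_const_mul, ← hp.two_mul_varDeriv]
  congr 1
  funext s
  simp only [evalDiff, map_mul, map_ofNat]
  ring

namespace IsTangentHat

variable {h : ℕ → DiffPoly} {m : ℕ} {γ V V' : ℝ → ℂ}

theorem mem_MHat (hV : IsTangentHat h m γ V) : γ ∈ MHat := by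
  obtain ⟨Γ, hΓ, -⟩ := hV
  exact hΓ.mem_MHat

theorem isRotation (hV : IsTangentHat h m γ V) :
    IsRotation (curvHat γ) (frameComp γ V) (angVel γ V) := by
  obtain ⟨Γ, hΓ, -⟩ := hV
  exact hΓ.isRotation

variable (hh : ∀ n, 1 ≤ n → IsMKdVDensity n (h n))
include hh

theorem isLevelTangent (hV : IsTangentHat h m γ V) :
    IsLevelTangent (curvHat γ) m (frameComp γ V) := by
  refine ⟨_, hV.isRotation, fun j hj => ?_⟩
  obtain ⟨Γ, hΓ, hd⟩ := hV
  have hvar := (hΓ.hasDerivAt_functionalHat (h (j + 1))).unique (hd (j + 1) (by omega) hj)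
  rw [← (hh (j + 1) (by omega)).integral_gradPoly_mul] at hvar
  linarith

theorem hasLenardChain (hV : IsTangentHat h m γ V) :
    HasLenardChain (miuraCurv (curvHat γ)) m (frameComp γ V) :=
  (hV.isLevelTangent hh).hasLenardChain (isSmoothPer_curvHat hV.mem_MHat)

theorem hasOmegaHat_iff (hV : IsTangentHat h m γ V) (hV' : IsTangentHat h m γ V') (w : ℂ) :
    HasOmegaHat (m + 1) γ V V' w ↔ w = omegaHat m γ V V' := by
  have hγ := hV.mem_MHat
  have homega {δ W W' : ℝ → ℂ × ℂ} (hδ : IsMiura γ δ) (hW : IsMiuraPush γ δ V W)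
      (hW' : IsMiuraPush γ δ V' W') : HasOmega (m + 1) δ W W' w ↔ w = omegaHat m γ V V' := by
    rw [omegaHat, (hV.isLevelTangent hh).ofReal_re_kdvForm (isSmoothPer_curvHat hγ)
      (hV'.isLevelTangent hh), ← hδ.curvC hγ]
    exact hasOmega_iff (hδ.mem_MC hγ) hW.represents hW'.represents
      (hδ.curvC hγ ▸ hV.hasLenardChain hh) (hδ.curvC hγ ▸ hV'.hasLenardChain hh)
  constructor
  · rintro ⟨δ, W, W', hδ, hW, hW', hw⟩
    exact (homega hδ hW hW').mp hw
  · intro hw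
    obtain ⟨δ, hδ⟩ := exists_isMiura hγ
    obtain ⟨Γ, hΓ, -⟩ := hV
    obtain ⟨Γ', hΓ', -⟩ := hV'
    obtain ⟨W, hW⟩ := hΓ.exists_isMiuraPush hδ
    obtain ⟨W', hW'⟩ := hΓ'.exists_isMiuraPush hδ
    exact ⟨δ, W, W', hδ, hW, hW', (homega hδ hW hW').mpr hw⟩

theorem omegaHat_antisymm (hV : IsTangentHat h m γ V) (hV' : IsTangentHat h m γ V') :
    omegaHat m γ V V' = -omegaHat m γ V' V := by
  rw [omegaHat, kdvForm_antisymm (isSmoothPer_curvHat hV.mem_MHat).miuraCurv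
    (hV.hasLenardChain hh) (hV'.hasLenardChain hh), Complex.neg_re, omegaHat]

theorem omegaHat_mul_add {V₁ V₂ : ℝ → ℂ} (r : ℝ) (hV : IsTangentHat h m γ V)
    (h₁ : IsTangentHat h m γ V₁) (h₂ : IsTangentHat h m γ V₂) :
    omegaHat m γ V (fun s => r * V₁ s + V₂ s) = r * omegaHat m γ V V₁ + omegaHat m γ V V₂ := by
  have hframe : frameComp γ (fun s => r * V₁ s + V₂ s) =
      fun s => r * frameComp γ V₁ s + frameComp γ V₂ s := by
    funext s
    simp only [frameComp]
    ring
  rw [omegaHat, hframe, kdvForm_mul_add r (isSmoothPer_curvHat hV.mem_MHat).miuraCurv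
    (hV.hasLenardChain hh) (h₁.hasLenardChain hh) (h₂.hasLenardChain hh), Complex.add_re,
    Complex.re_ofReal_mul, omegaHat, omegaHat]

theorem omegaHat_shift (hV : IsTangentHat h m γ V) (hV' : IsTangentHat h m γ V') (σ : ℝ) :
    omegaHat m (ClosedCurves.shift σ γ) (ClosedCurves.shift σ V) (ClosedCurves.shift σ V') =
      omegaHat m γ V V' := by
  rw [omegaHat, curvHat_shift, miuraCurv_comp_add, frameComp_shift, frameComp_shift,
    kdvForm_comp_add (isSmoothPer_curvHat hV.mem_MHat).miuraCurv (hV.hasLenardChain hh)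
      (hV'.hasLenardChain hh), omegaHat]

theorem omegaHat_fundamentalField (hV : IsTangentHat h m γ V) :
    omegaHat m γ (fundamentalField γ) V = ∫ s in 0..2 * π,
      evalDiff (curvHat γ) (varDeriv (h (m + 1))) s * deriv (angVel γ V) s := by
  rw [omegaHat, frameComp_fundamentalField hV.mem_MHat,
    kdvForm_one_left (isSmoothPer_curvHat hV.mem_MHat) (hV.hasLenardChain hh) hV.isRotation,
    Complex.ofReal_re, (hh (m + 1) (by omega)).integral_gradPoly_mul]

end IsTangentHat

variable {h : ℕ → DiffPoly} (hh : ∀ n, 1 ≤ n → IsMKdVDensity n (h n)) (c : ℕ → ℝ) (m : ℕ)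
include hh

theorem isTwoForm_omegaHat : IsTwoForm (levelHat h c m) (IsTangentHat h m) (omegaHat m) where
  skew _ _ _ _ hV hV' := hV.omegaHat_antisymm hh hV'
  linear _ _ _ _ _ _ r hV h₁ h₂ _ he := funext he ▸ hV.omegaHat_mul_add hh r h₁ h₂

theorem isShiftMomentMap_functionalHat :
    IsShiftMomentMap (levelHat h c m) (IsTangentHat h m) (omegaHat m)
      (functionalHat (h (m + 1))) where
  maps _ hγ σ := shift_mem_levelHat hγ σ
  maps_tangent _ _ σ _ hV := hV.shift σ
  form_invariant _ _ σ _ _ hV hV' := hV.omegaHat_shift hh hV' σ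
  moment_invariant _ hγ σ := functionalHat_shift hγ.1 _ σ
  fundamental_tangent _ hγ := isTangentHat_fundamentalField hγ.1 h m
  differential _ _ _ hV _ hΓ := hV.omegaHat_fundamentalField hh ▸ hΓ.hasDerivAt_functionalHat _

end OmegaHat

end ClosedCurves

end

theorem theorem5p3 :
    (∀ n : ℕ, 1 ≤ n → ∃ p, ClosedCurves.IsMKdVDensity n p) ∧
    ∀ (h : ℕ → ClosedCurves.DiffPoly) (_ : ∀ n, 1 ≤ n → ClosedCurves.IsMKdVDensity n (h n))
      (c : ℕ → ℝ) (m : ℕ) (_ : 1 ≤ m),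
      ∃ form : (ℝ → ℂ) → (ℝ → ℂ) → (ℝ → ℂ) → ℝ,
        (∀ γ ∈ ClosedCurves.levelHat h c m, ∀ V V' : ℝ → ℂ,
          ClosedCurves.IsTangentHat h m γ V → ClosedCurves.IsTangentHat h m γ V' →
          ∀ w : ℂ, ClosedCurves.HasOmegaHat (m + 1) γ V V' w ↔ w = (form γ V V' : ℂ)) ∧
        ClosedCurves.IsTwoForm (ClosedCurves.levelHat h c m)
          (ClosedCurves.IsTangentHat h m) form ∧
        ClosedCurves.IsShiftMomentMap (ClosedCurves.levelHat h c m)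
          (ClosedCurves.IsTangentHat h m) form (ClosedCurves.functionalHat (h (m + 1))) := by
  refine ⟨ClosedCurves.exists_isMKdVDensity, fun h hh c m _ => ⟨ClosedCurves.omegaHat m, ?_,
    ClosedCurves.isTwoForm_omegaHat hh c m, ClosedCurves.isShiftMomentMap_functionalHat hh c m⟩⟩
  exact fun γ _ V V' hV hV' w => hV.hasOmegaHat_iff hh hV' w
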